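/- Let $\Omega=\Omega(\hat{\mathbb C}\setminus\{(0),1,\infty\})$ be the Riemann surface whose points are the homotopy classes of admissible curves. Here a continuous curve $\gamma:[0,1]\to\mathbb C$ with $\gamma(0)=0$ is admissible if it is constant or satisfies $\gamma(t)\in\mathbb C\setminus\{0,1\}=\hat{\mathbb C}\setminus\{0,1,\infty\}$ for all $0<t\le 1$, and homotopies run through admissible curves with a fixed endpoint. The surface $\Omega$ carries the quotient of the topology of uniform convergence of curves, and its charts are the restrictions of the endpoint projection $p:\Omega\to\mathbb C$, $p([\gamma])=\gamma(1)$, to open sets on which $p$ is a homeomorphism onto an open subset of $\mathbb C$. Write $0_\Omega$ for the class of the constant curve, and let $$\mathbb K(\omega)=\int_0^{\pi/2}\frac{d\theta}{\sqrt{1-\omega\sin^2\theta}},\qquad \omega\in\mathbb C\setminus[1,\infty),$$ with the principal branch of the square root. Then there is a biholomorphic map $\psi:\Omega\to\mathbb D$ onto the open unit disc with $\psi(0_\Omega)=0$, given by the elliptic nome $$\psi(\omega)=q(\omega)=\exp\left(-\pi\,\frac{\mathbb K(1-\omega)}{\mathbb K(\omega)}\right)$$ in the following sense. 1. For $\omega\in\mathbb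 C\setminus\big((-\infty,0]\cup[1,\infty)\big)$ we have $\mathbb K(\omega)\neq 0$, and the formula holds with the principal branches at the class of the segment $t\mapsto t\omega$. 2. Let $\gamma$ be any admissible curve, and let $t_0\in[0,1]$ be such that $|\gamma(t)|<1$ for $t\le t_0$ and $\gamma(t_0)\notin(-\infty,0]$. Then the principal germs of $\omega\mapsto\mathbb K(\omega)$ and $\omega\mapsto\mathbb K(1-\omega)$ at $\gamma(t_0)$ can be continued analytically along $\gamma|_{[t_0,1]}$. Their final values $k,k'$ at $\gamma(1)$ satisfy $k\ne0$ and $\psi([\gamma])=e^{-\pi k'/k}$. The inverse nome $\varphi=p\circ\psi^{-1}:\mathbb D\to\mathbb C$ is given on all of $\mathbb D$ by a convergent power series $$\varphi(z)=16z-128z^2+704z^3+\cdots .$$ -/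

import Mathlib

open Set Filter Topology
open scoped Manifold ContDiff

noncomputable section

namespace NomeSurface

/-- An admissible curve: it starts at `0` and is either constant or, after leaving `0`
immediately, stays in `ℂ ∖ {0, 1} = Ĉ ∖ {0, 1, ∞}`. -/
def IsCurve (γ : C(unitInterval, ℂ)) : Prop :=
  γ 0 = 0 ∧ ((∀ t, γ t = 0) ∨ ∀ t, t ≠ 0 → γ t ≠ 0 ∧ γ t ≠ 1)

/-- The space of admissible curves, with the topology of uniform convergence. -/
abbrev Curve : Type := {γ : C(unitInterval, ℂ) // IsCurve γ}

/-- Homotopy of admissible curves, through admissible curves with the same endpoint. -/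
instance curveSetoid : Setoid Curve where
  r γ η := ContinuousMap.HomotopicWith γ.1 η.1 (fun f => IsCurve f ∧ f 1 = γ.1 1)
  iseqv := by
    have key : ∀ γ η : Curve,
        ContinuousMap.HomotopicWith γ.1 η.1 (fun f => IsCurve f ∧ f 1 = γ.1 1) →
        η.1 1 = γ.1 1 := by
      rintro γ η ⟨H⟩
      have := (H.prop 1).2
      simpa using this
    refine ⟨fun γ => .refl _ ⟨γ.2, rfl⟩, fun {γ η} h => ?_, fun {γ η ζ} h₁ h₂ => ?_⟩
    · have := h.symm
      rwa [← key _ _ h] at this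
    · rw [key _ _ h₁] at h₂
      exact h₁.trans h₂

/-- The surface `Ω(Ĉ ∖ {(0), 1, ∞})`: homotopy classes of admissible curves, with the
quotient topology. -/
def Surface : Type := Quotient curveSetoid

instance : TopologicalSpace Surface := inferInstanceAs (TopologicalSpace (Quotient curveSetoid))

/-- The homotopy class of an admissible curve. -/
def Surface.mk (γ : Curve) : Surface := Quotient.mk curveSetoid γ

theorem end_eq {γ η : Curve} (h : γ ≈ η) : η.1 1 = γ.1 1 := by
  obtain ⟨H⟩ := h
  simpa using (H.prop 1).2

/-- The projection to the plane: the common endpoint of the curves of a class. -/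
def Surface.proj : Surface → ℂ :=
  Quotient.lift (fun γ : Curve => γ.1 1) fun _ _ h => (end_eq h).symm

/-- The straight curve `t ↦ t w` as a continuous map. -/
def segMap (w : ℂ) : C(unitInterval, ℂ) := ⟨fun t => (t : ℝ) * w, by fun_prop⟩

theorem segMap_isCurve {w : ℂ} (h : w ∉ Complex.ofReal '' Ici (1 : ℝ)) : IsCurve (segMap w) := by
  refine ⟨by simp [segMap], ?_⟩
  by_cases h0 : w = 0
  · left; intro t; simp [segMap, h0]
  · right
    intro t ht
    have ht0 : (t : ℝ) ≠ 0 := fun h => ht (Subtype.ext h)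
    have htp : 0 < (t : ℝ) := lt_of_le_of_ne t.2.1 (Ne.symm ht0)
    refine ⟨by simp [segMap, h0, ht0], fun h1 => h ⟨(t : ℝ)⁻¹, ?_, ?_⟩⟩
    · exact (one_le_inv₀ htp).2 t.2.2
    · have : ((t : ℝ) : ℂ) * w = 1 := h1
      push_cast
      exact (eq_inv_of_mul_eq_one_right this).symm

theorem logLift (η η₀ : C(unitInterval, ℂ)) (h : ∀ t, t ≠ 0 → η t ≠ 0)
    (h₀ : ∀ t, t ≠ 0 → η₀ t ≠ 0) (he : η 1 = η₀ 1) :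
    ∃ D : unitInterval → ℂ, ContinuousOn D {0}ᶜ ∧ D 1 = 0 ∧
      ∀ t, t ≠ 0 → η t = η₀ t * Complex.exp (D t) := by
  set P : ℝ → unitInterval := projIcc 0 1 zero_le_one with hP
  have hPc : Continuous P := continuous_projIcc
  have hP0 : ∀ t : ℝ, 0 < t → P t ≠ 0 := by
    intro t ht h
    have : ((P t : unitInterval) : ℝ) = 0 := by rw [h]; rfl
    rw [hP, coe_projIcc] at this
    have h2 : 0 < min 1 t := lt_min one_pos ht
    have h3 := le_max_right 0 (min 1 t)
    linarith
  have hsc : IsSimplyConnected (Ioi (0 : ℝ)) :=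
    by
    have := Convex.contractibleSpace (convex_Ioi (0 : ℝ)) ⟨1, by simp⟩
    exact SimplyConnectedSpace.ofContractible _
  obtain ⟨f, hf, hfe⟩ := Complex.exists_continuousOn_eqOn_exp_comp hsc isOpen_Ioi
    (g := fun t => η (P t) / η₀ (P t))
    (ContinuousOn.div (by fun_prop) (by fun_prop) fun t ht => h₀ _ (hP0 t ht))
    (by
      rintro ⟨t, ht, h1⟩
      exact div_ne_zero (h _ (hP0 t ht)) (h₀ _ (hP0 t ht)) h1)
  have hPt : ∀ t : unitInterval, P t = t := fun t => projIcc_val zero_le_one t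
  have hpos : ∀ t : unitInterval, t ≠ 0 → (0 : ℝ) < t := fun t ht =>
    lt_of_le_of_ne t.2.1 fun h => ht (Subtype.ext h.symm)
  have hexp : ∀ t : unitInterval, t ≠ 0 → Complex.exp (f t) = η t / η₀ t := by
    intro t ht
    have := hfe (hpos t ht)
    simpa [hPt] using this
  have hexp1 : Complex.exp (f 1) = 1 := by
    have := hexp 1 (by simp)
    rw [he, div_self (h₀ 1 (by simp))] at this
    simpa using this
  refine ⟨fun t => f t - f 1, ?_, by simp, fun t ht => ?_⟩
  · refine ContinuousOn.sub (hf.comp (by fun_prop) fun t ht => hpos t ht) continuousOn_const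
  · rw [Complex.exp_sub, hexp t ht, hexp1, div_one, mul_div_cancel₀ _ (h₀ t ht)]

theorem homotopic_of_log {η η₀ : Curve} (h₀ : ∀ t, t ≠ 0 → η₀.1 t ≠ 0)
    {D : unitInterval → ℂ} (hD : ContinuousOn D {0}ᶜ) (hD1 : D 1 = 0)
    (hη : ∀ t, t ≠ 0 → η.1 t = η₀.1 t * Complex.exp (D t))
    (hav : ∀ t, t ≠ 0 → (‖η₀.1 t‖ < 1 ∧ ‖η.1 t‖ < 1) ∨
      ∀ s : unitInterval, η₀.1 t * Complex.exp ((s : ℝ) * D t) ≠ 1) : η₀ ≈ η := by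
  classical
  set F : unitInterval × unitInterval → ℂ := fun x =>
    if x.2 = 0 then 0 else η₀.1 x.2 * Complex.exp ((x.1 : ℝ) * D x.2) with hF
  have hbound : ∀ x, ‖F x‖ ≤ max ‖η₀.1 x.2‖ ‖η.1 x.2‖ := by
    intro ⟨s, t⟩
    by_cases ht : t = 0
    · simp [hF, ht]
    · simp only [hF, ht, if_false, hη t ht, norm_mul, Complex.norm_exp]
      have h1 : (((s : ℝ) : ℂ) * D t).re = s * (D t).re := by simp
      rw [h1]
      rcases le_total 0 (D t).re with h | h
      · refine le_max_of_le_right ?_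
        gcongr
        exact mul_le_of_le_one_left h s.2.2
      · refine le_max_of_le_left ?_
        refine mul_le_of_le_one_right (norm_nonneg _) ?_
        exact Real.exp_le_one_iff.2 (mul_nonpos_of_nonneg_of_nonpos s.2.1 h)
  have hFc : Continuous F := by
    rw [continuous_iff_continuousAt]
    rintro ⟨s, t⟩
    by_cases ht : t = 0
    · subst ht
      have hz : F (s, 0) = 0 := by simp [hF]
      rw [ContinuousAt, hz]
      refine squeeze_zero_norm hbound ?_
      have hc : Continuous fun x : unitInterval × unitInterval =>
          max ‖η₀.1 x.2‖ ‖η.1 x.2‖ := by fun_prop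
      have := hc.tendsto (s, 0)
      simpa [η₀.2.1, η.2.1] using this
    · have hev : F =ᶠ[𝓝 (s, t)] fun x => η₀.1 x.2 * Complex.exp ((x.1 : ℝ) * D x.2) := by
        have : ∀ᶠ x : unitInterval × unitInterval in 𝓝 (s, t), x.2 ≠ 0 :=
          continuousAt_snd.eventually_ne ht
        filter_upwards [this] with x hx
        simp [hF, hx]
      refine ContinuousAt.congr ?_ hev.symm
      have hDt : ContinuousAt (fun x : unitInterval × unitInterval => D x.2) (s, t) :=
        ContinuousAt.comp (f := Prod.snd) (x := (s, t))
          (hD.continuousAt (isOpen_compl_singleton.mem_nhds ht)) continuousAt_snd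
      have hs : ContinuousAt (fun x : unitInterval × unitInterval => ((x.1 : ℝ) : ℂ)) (s, t) :=
        Continuous.continuousAt (by fun_prop)
      have hη₀ : ContinuousAt (fun x : unitInterval × unitInterval => η₀.1 x.2) (s, t) :=
        Continuous.continuousAt (by fun_prop)
      exact hη₀.mul (hs.mul hDt).cexp
  refine ⟨⟨⟨⟨F, hFc⟩, fun t => ?_, fun t => ?_⟩, fun s => ⟨⟨?_, Or.inr fun t ht => ?_⟩, ?_⟩⟩⟩
  · by_cases ht : t = 0
    · simp [hF, ht, η₀.2.1]
    · simp [hF, ht]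
  · by_cases ht : t = 0
    · simp [hF, ht, η.2.1]
    · simp [hF, ht, hη t ht]
  · simp [hF]
  · constructor
    · simp [hF, ht, h₀ t ht]
    · rcases hav t ht with h | h
      · intro h1
        have h2 := hbound (s, t)
        have h3 : F (s, t) = 1 := h1
        rw [h3, norm_one] at h2
        exact absurd h2 (not_le.2 (max_lt h.1 h.2))
      · have := h s
        simpa [hF, ht] using this
  · simp [hF, hD1]


theorem Curve.ne_of_end {γ : Curve} (h : γ.1 1 ≠ 0) (t : unitInterval) (ht : t ≠ 0) :
    γ.1 t ≠ 0 ∧ γ.1 t ≠ 1 := by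
  rcases γ.2.2 with h' | h'
  · exact absurd (h' 1) h
  · exact h' t ht

theorem isCurve_smul {γ : Curve} (h : γ.1 1 ≠ 0) {c : ℂ} (hc : c ≠ 0) (hr : c⁻¹ ∉ range γ.1) :
    IsCurve (c • γ.1) := by
  refine ⟨by simp [γ.2.1], Or.inr fun t ht => ⟨?_, fun h1 => hr ⟨t, ?_⟩⟩⟩
  · simpa using ⟨hc, (γ.ne_of_end h t ht).1⟩
  · exact eq_inv_of_mul_eq_one_right h1

theorem Curve.one_notMem (γ : Curve) : (1 : ℂ) ∉ range γ.1 := by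
  rintro ⟨t, ht⟩
  by_cases h0 : t = 0
  · rw [h0, γ.2.1] at ht; exact zero_ne_one ht
  · rcases γ.2.2 with h | h
    · rw [h t] at ht; exact zero_ne_one ht
    · exact (h t h0).2 ht

theorem eventually_inv_notMem {X : Type*} [TopologicalSpace X] [CompactSpace X] (f : C(X, ℂ))
    (h : (1 : ℂ) ∉ range f) : ∀ᶠ c in 𝓝 (1 : ℂ), c ≠ 0 ∧ c⁻¹ ∉ range f := by
  have h1 : Tendsto (fun c : ℂ => c⁻¹) (𝓝 1) (𝓝 1) := by
    simpa using tendsto_inv₀ (one_ne_zero (α := ℂ))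
  have h2 : (range f)ᶜ ∈ 𝓝 (1 : ℂ) := (isCompact_range f.continuous).isClosed.isOpen_compl.mem_nhds h
  exact (eventually_ne_nhds one_ne_zero).and (h1 h2)

theorem homotopic_smul {η₀ η₁ : Curve} (hη : η₀.1 1 ≠ 0) (h : η₀ ≈ η₁) :
    ∀ᶠ c in 𝓝 (1 : ℂ), ∀ (h₀ : IsCurve (c • η₀.1)) (h₁ : IsCurve (c • η₁.1)),
      (⟨_, h₀⟩ : Curve) ≈ ⟨_, h₁⟩ := by
  obtain ⟨H⟩ := h
  have hcur : ∀ s, IsCurve (H.toHomotopy.curry s) := fun s => (H.prop s).1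
  have hend : ∀ s, H.toHomotopy.curry s 1 = η₀.1 1 := fun s => (H.prop s).2
  have h1 : (1 : ℂ) ∉ range H.toContinuousMap := by
    rintro ⟨⟨s, t⟩, hst⟩
    exact Curve.one_notMem ⟨_, hcur s⟩ ⟨t, hst⟩
  filter_upwards [eventually_inv_notMem _ h1] with c hc h₀ h₁
  refine ⟨⟨⟨c • H.toContinuousMap, fun t => ?_, fun t => ?_⟩, fun s => ⟨?_, ?_⟩⟩⟩
  · exact congrArg (c * ·) (H.apply_zero t)
  · exact congrArg (c * ·) (H.apply_one t)
  · exact isCurve_smul (γ := ⟨_, hcur s⟩) (by simpa only [hend s] using hη) hc.1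
      fun ⟨t, ht⟩ => hc.2 ⟨(s, t), ht⟩
  · exact congrArg (c * ·) (hend s)

theorem eventually_homotopic {η₀ : Curve} (h0 : η₀.1 1 ≠ 0) :
    ∀ᶠ η : Curve in 𝓝 η₀, ∃ h : IsCurve ((η.1 1 / η₀.1 1) • η₀.1), (⟨_, h⟩ : Curve) ≈ η := by
  have hev : Continuous fun x : Curve × unitInterval => x.1.1 x.2 := by fun_prop
  have hev1 : Continuous fun x : Curve => x.1 1 := by fun_prop
  -- the scaling factor tends to `1`
  have hc : Tendsto (fun η : Curve => η.1 1 / η₀.1 1) (𝓝 η₀) (𝓝 1) := by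
    have := (hev1.tendsto η₀).div_const (η₀.1 1)
    rwa [div_self h0] at this
  -- an initial piece of the interval on which everything is small
  obtain ⟨ε, hε0, hε⟩ : ∃ ε : unitInterval, 0 < ε ∧ ∀ t, t ≤ ε → ‖η₀.1 t‖ < 1 / 2 := by
    have h1 : ∀ᶠ t in 𝓝 (0 : unitInterval), ‖η₀.1 t‖ < 1 / 2 := by
      have : Tendsto (fun t => ‖η₀.1 t‖) (𝓝 0) (𝓝 ‖η₀.1 0‖) :=
        (η₀.1.continuous.norm).tendsto 0
      rw [η₀.2.1, norm_zero] at this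
      exact this.eventually (gt_mem_nhds (by norm_num))
    obtain ⟨u, hu, hu'⟩ := exists_Ico_subset_of_mem_nhds h1 ⟨1, zero_lt_one⟩
    obtain ⟨ε, h2, h3⟩ := exists_between hu
    exact ⟨ε, h2, fun t ht => hu' ⟨t.2.1, ht.trans_lt h3⟩⟩
  have hsmall : ∀ᶠ η : Curve in 𝓝 η₀, ∀ t ∈ Iic ε,
      ‖(η.1 1 / η₀.1 1) • η₀.1 t‖ < 1 ∧ ‖η.1 t‖ < 1 := by
    refine isClosed_Iic.isCompact.eventually_forall_of_forall_eventually fun t ht => ?_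
    have c1 : Continuous fun x : Curve × unitInterval =>
        ‖(x.1.1 1 / η₀.1 1) • η₀.1 x.2‖ := by fun_prop
    have c2 : Continuous fun x : Curve × unitInterval => ‖x.1.1 x.2‖ := by fun_prop
    have := hε t ht
    refine ((c1.tendsto (η₀, t)).eventually (gt_mem_nhds ?_)).and
      ((c2.tendsto (η₀, t)).eventually (gt_mem_nhds ?_))
    · rw [div_self h0, one_smul]; linarith
    · linarith
  -- the remaining piece
  have hK : IsCompact (Ici ε ×ˢ (univ : Set unitInterval)) := isClosed_Ici.isCompact.prod isCompact_univ
  have hlarge : ∀ᶠ η : Curve in 𝓝 η₀, ∀ x ∈ Ici ε ×ˢ (univ : Set unitInterval),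
      η.1 x.1 / ((η.1 1 / η₀.1 1) • η₀.1 x.1) ∈ Complex.slitPlane ∧
      ((η.1 1 / η₀.1 1) • η₀.1 x.1) * Complex.exp ((x.2 : ℝ) *
        Complex.log (η.1 x.1 / ((η.1 1 / η₀.1 1) • η₀.1 x.1))) ≠ 1 := by
    refine hK.eventually_forall_of_forall_eventually fun ⟨t, s⟩ hts => ?_
    have ht : t ≠ 0 := fun h => absurd (h ▸ hts.1 : ε ≤ 0) (not_le.2 hε0)
    have hne := η₀.ne_of_end h0 t ht
    have c1 : Continuous fun x : Curve × (unitInterval × unitInterval) =>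
        (x.1.1 1 / η₀.1 1) • η₀.1 x.2.1 := by fun_prop
    have c2 : Continuous fun x : Curve × (unitInterval × unitInterval) => x.1.1 x.2.1 := by
      fun_prop
    have c3 : Continuous fun x : Curve × (unitInterval × unitInterval) =>
        ((x.2.2 : ℝ) : ℂ) := by fun_prop
    have hv : (η₀.1 1 / η₀.1 1) • η₀.1 t = η₀.1 t := by rw [div_self h0, one_smul]
    have cq : ContinuousAt (fun x : Curve × (unitInterval × unitInterval) =>
        x.1.1 x.2.1 / ((x.1.1 1 / η₀.1 1) • η₀.1 x.2.1)) (η₀, (t, s)) :=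
      c2.continuousAt.div c1.continuousAt (by simpa only [hv] using hne.1)
    have hq : η₀.1 t / ((η₀.1 1 / η₀.1 1) • η₀.1 t) = 1 := by rw [hv, div_self hne.1]
    have hsl : η₀.1 t / ((η₀.1 1 / η₀.1 1) • η₀.1 t) ∈ Complex.slitPlane := by
      rw [hq]; exact Complex.one_mem_slitPlane
    refine (cq.eventually (Complex.isOpen_slitPlane.mem_nhds hsl)).and ?_
    refine (c1.continuousAt.mul (c3.continuousAt.mul (cq.clog hsl)).cexp).eventually_ne ?_
    change (η₀.1 1 / η₀.1 1) • η₀.1 t * Complex.exp ((s : ℝ) *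
      Complex.log (η₀.1 t / ((η₀.1 1 / η₀.1 1) • η₀.1 t))) ≠ 1
    rw [hq, hv, Complex.log_one, mul_zero, Complex.exp_zero, mul_one]
    exact hne.2
  filter_upwards [hsmall, hlarge, hc.eventually (eventually_inv_notMem _ η₀.one_notMem),
    hev1.continuousAt.eventually_ne h0] with η hs hl hη hη1
  refine ⟨isCurve_smul h0 hη.1 hη.2, ?_⟩
  set ζ : Curve := ⟨_, isCurve_smul h0 hη.1 hη.2⟩ with hζ
  have hζ1 : ζ.1 1 = η.1 1 := div_mul_cancel₀ _ h0
  have hζ0 : ζ.1 1 ≠ 0 := by rwa [hζ1]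
  obtain ⟨D, hD, hD1, hDe⟩ := logLift η.1 ζ.1 (fun t ht => (η.ne_of_end hη1 t ht).1)
    (fun t ht => (ζ.ne_of_end hζ0 t ht).1) hζ1.symm
  have hI0 : ∀ t ∈ Ici ε, t ≠ 0 := fun t ht h => absurd (h ▸ ht : ε ≤ 0) (not_le.2 hε0)
  have hlog : EqOn D (fun t => Complex.log (η.1 t / ζ.1 t)) (Ici ε) := by
    refine Complex.isCoveringMap_exp.eqOn_of_comp_eqOn isPreconnected_Ici
      (hD.mono fun t ht => hI0 t ht) ?_ ?_ (a := 1) unitInterval.le_one' ?_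
    · refine ContinuousOn.clog (ContinuousOn.div (by fun_prop) (by fun_prop)
        fun t ht => (ζ.ne_of_end hζ0 t (hI0 t ht)).1) fun t ht => ?_
      exact (hl (t, 0) ⟨ht, mem_univ _⟩).1
    · intro t ht
      have hz := (ζ.ne_of_end hζ0 t (hI0 t ht)).1
      have hn := (η.ne_of_end hη1 t (hI0 t ht)).1
      refine Subtype.ext ?_
      simp only [Function.comp]
      rw [Complex.exp_log (div_ne_zero hn hz), hDe t (hI0 t ht), mul_div_cancel_left₀ _ hz]
    · rw [hD1, hζ1, div_self hη1, Complex.log_one]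
  refine homotopic_of_log (fun t ht => (ζ.ne_of_end hζ0 t ht).1) hD hD1 hDe fun t ht => ?_
  rcases le_total t ε with h | h
  · exact Or.inl (hs t h)
  · right
    intro s
    rw [hlog h]
    exact (hl (t, s) ⟨h, mem_univ _⟩).2

theorem homotopic_of_norm_lt {η η₀ : Curve} (h₀ : ∀ t, ‖η₀.1 t‖ < 1) (h : ∀ t, ‖η.1 t‖ < 1)
    (he : η.1 1 = η₀.1 1) : η₀ ≈ η := by
  by_cases h0 : η₀.1 1 = 0
  · have hz : ∀ γ : Curve, γ.1 1 = 0 → ∀ t, γ.1 t = 0 := fun γ hγ =>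
      γ.2.2.resolve_right fun h' => (h' 1 (by simp)).1 hγ
    have : η₀ = η := Subtype.ext <| ContinuousMap.ext fun t => by
      rw [hz η₀ h0, hz η (he.trans h0)]
    rw [this]
  · have h1 : η.1 1 ≠ 0 := he ▸ h0
    obtain ⟨D, hD, hD1, hDe⟩ := logLift η.1 η₀.1 (fun t ht => (η.ne_of_end h1 t ht).1)
      (fun t ht => (η₀.ne_of_end h0 t ht).1) he
    exact homotopic_of_log (fun t ht => (η₀.ne_of_end h0 t ht).1) hD hD1 hDe
      fun t _ => Or.inl ⟨h₀ t, h t⟩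

theorem Surface.continuous_mk : Continuous Surface.mk := continuous_quotient_mk'

theorem Surface.continuous_proj : Continuous Surface.proj :=
  Continuous.quotient_lift (by fun_prop) _

/-- A chart of the surface from a continuous family of curves with prescribed endpoints. -/
theorem exists_chart {V : Set ℂ} (hV : IsOpen V) (c : V → Curve) (hc : Continuous c)
    (he : ∀ v, (c v).1 1 = v)
    (ho : ∀ (v : V) (η : Curve), c v ≈ η →
      ∀ᶠ η' : Curve in 𝓝 η, ∃ h : η'.1 1 ∈ V, c ⟨_, h⟩ ≈ η') (v : V) :
    ∃ e : OpenPartialHomeomorph Surface ℂ, Surface.mk (c v) ∈ e.source ∧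
      Surface.proj = e := by
  classical
  let g : ℂ → Surface := fun z => if h : z ∈ V then Surface.mk (c ⟨z, h⟩) else Surface.mk (c v)
  have hg : ∀ (z : ℂ) (h : z ∈ V), g z = Surface.mk (c ⟨z, h⟩) := fun z h => dif_pos h
  have hpg : ∀ z ∈ V, Surface.proj (g z) = z := fun z h => by
    rw [hg z h]; exact he ⟨z, h⟩
  refine ⟨{ toFun := Surface.proj, invFun := g, source := g '' V, target := V
            map_source' := ?_, map_target' := fun z h => mem_image_of_mem g h
            left_inv' := ?_, right_inv' := hpg
            open_source := ?_, open_target := hV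
            continuousOn_toFun := Surface.continuous_proj.continuousOn
            continuousOn_invFun := ?_ }, ⟨v, v.2, hg v v.2⟩, rfl⟩
  · rintro _ ⟨z, h, rfl⟩; rw [hpg z h]; exact h
  · rintro _ ⟨z, h, rfl⟩; rw [hpg z h]
  · rw [continuousOn_iff_continuous_domRestrict]
    have : V.domRestrict g = Surface.mk ∘ c := funext fun z => hg z z.2
    rw [this]
    exact Surface.continuous_mk.comp hc
  · change IsOpen (Quotient.mk curveSetoid ⁻¹' (g '' V))
    rw [isOpen_iff_mem_nhds]
    rintro η ⟨z, h, hz⟩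
    rw [hg z h] at hz
    filter_upwards [ho ⟨z, h⟩ η (Quotient.exact hz)] with η' hη'
    obtain ⟨h', hh⟩ := hη'
    exact ⟨_, h', (hg _ h').trans (Quotient.sound hh)⟩

theorem eventually_of_smul {γ η : Curve} (hγ : γ.1 1 ≠ 0) (h : γ ≈ η) :
    ∀ᶠ η' : Curve in 𝓝 η, ∃ h : IsCurve ((η'.1 1 / γ.1 1) • γ.1), (⟨_, h⟩ : Curve) ≈ η' := by
  have he := end_eq h
  have hη : η.1 1 ≠ 0 := he ▸ hγ
  have hc : Tendsto (fun η' : Curve => η'.1 1 / γ.1 1) (𝓝 η) (𝓝 1) := by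
    have hev1 : Continuous fun x : Curve => x.1 1 := by fun_prop
    have := (hev1.tendsto η).div_const (γ.1 1)
    rwa [he, div_self hγ] at this
  filter_upwards [eventually_homotopic hη, hc.eventually (homotopic_smul hγ h),
    hc.eventually (eventually_inv_notMem _ γ.one_notMem)] with η' h1 h2 h3
  have h4 := isCurve_smul hγ h3.1 h3.2
  obtain ⟨h5, h6⟩ := h1
  refine ⟨h4, Setoid.trans (h2 h4 (by rwa [he] at h5)) ?_⟩
  simpa only [he] using h6

theorem notMem_of_norm_lt {v : ℂ} (h : ‖v‖ < 1) : v ∉ Complex.ofReal '' Ici (1 : ℝ) := by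
  rintro ⟨x, hx, rfl⟩
  rw [Complex.norm_real, Real.norm_eq_abs] at h
  exact absurd (hx.trans (le_abs_self x)) (not_le.2 h)

/-- The endpoint projection is a local homeomorphism. -/
theorem Surface.isLocalHomeomorph_proj : IsLocalHomeomorph Surface.proj := by
  rintro ⟨γ⟩
  by_cases h0 : γ.1 1 = 0
  · have hz : ∀ t, γ.1 t = 0 := γ.2.2.resolve_right fun h' => (h' 1 (by simp)).1 h0
    let c : Metric.ball (0 : ℂ) 1 → Curve := fun v =>
      ⟨segMap v, segMap_isCurve (notMem_of_norm_lt (mem_ball_zero_iff.1 v.2))⟩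
    have hc : Continuous c := by
      refine Continuous.subtype_mk ?_ _
      refine ContinuousMap.continuous_of_continuous_uncurry _ ?_
      change Continuous fun x : Metric.ball (0 : ℂ) 1 × unitInterval => ((x.2 : ℝ) : ℂ) * x.1
      fun_prop
    have hce : ∀ v, (c v).1 1 = v := fun v => by simp [c, segMap]
    have hcn : ∀ v t, ‖(c v).1 t‖ < 1 := fun v t => by
      have h1 : ‖(v : ℂ)‖ < 1 := mem_ball_zero_iff.1 v.2
      have h2 : ‖(c v).1 t‖ = (t : ℝ) * ‖(v : ℂ)‖ := by
        simp [c, segMap, abs_of_nonneg t.2.1]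
      rw [h2]
      exact (mul_le_of_le_one_left (norm_nonneg _) t.2.2).trans_lt h1
    have hγ : γ = c ⟨0, by simp⟩ := Subtype.ext <| ContinuousMap.ext fun t => by
      rw [hz t]; simp [c, segMap]
    have := exists_chart Metric.isOpen_ball c hc hce ?_ ⟨0, by simp⟩
    · rwa [← hγ] at this
    · intro v η hη
      by_cases hv : (v : ℂ) = 0
      · have hη0 : η.1 1 = 0 := by rw [end_eq hη, hce, hv]
        have hηz : ∀ t, η.1 t = 0 := η.2.2.resolve_right fun h' => (h' 1 (by simp)).1 hη0
        have : ∀ᶠ η' : Curve in 𝓝 η, ∀ t ∈ (univ : Set unitInterval), ‖η'.1 t‖ < 1 := by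
          refine isCompact_univ.eventually_forall_of_forall_eventually fun t _ => ?_
          have c2 : Continuous fun x : Curve × unitInterval => ‖x.1.1 x.2‖ := by fun_prop
          refine (c2.tendsto (η, t)).eventually (gt_mem_nhds ?_)
          simp [hηz]
        filter_upwards [this] with η' h'
        have hm : η'.1 1 ∈ Metric.ball (0 : ℂ) 1 := by simpa using h' 1 (mem_univ _)
        exact ⟨hm, homotopic_of_norm_lt (hcn _) (fun t => h' t (mem_univ _)) (hce ⟨_, hm⟩).symm⟩
      · have hv1 : (c v).1 1 ≠ 0 := by rwa [hce]
        have hev1 : Continuous fun x : Curve => x.1 1 := by fun_prop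
        have hm : ∀ᶠ η' : Curve in 𝓝 η, η'.1 1 ∈ Metric.ball (0 : ℂ) 1 := by
          refine hev1.continuousAt.eventually (Metric.isOpen_ball.mem_nhds ?_)
          change η.1 1 ∈ _
          rw [end_eq hη, hce]; exact v.2
        filter_upwards [eventually_of_smul hv1 hη, hm] with η' h1 h2
        obtain ⟨h3, h4⟩ := h1
        refine ⟨h2, ?_⟩
        have : c ⟨_, h2⟩ = ⟨_, h3⟩ := Subtype.ext <| ContinuousMap.ext fun t => by
          change ((t : ℝ) : ℂ) * η'.1 1 = (η'.1 1 / (c v).1 1) * ((t : ℝ) * v)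
          rw [hce]
          field_simp
        rwa [this]
  · let V : Set ℂ := {v | v ≠ 0 ∧ γ.1 1 / v ∉ range γ.1}
    have hV : IsOpen V := by
      rw [isOpen_iff_mem_nhds]
      rintro v ⟨hv, hv'⟩
      have h1 : ContinuousAt (fun v => γ.1 1 / v) v := continuousAt_const.div continuousAt_id hv
      exact (eventually_ne_nhds hv).and
        (h1 ((isCompact_range γ.1.continuous).isClosed.isOpen_compl.mem_nhds hv'))
    have hcur : ∀ v ∈ V, IsCurve ((v / γ.1 1) • γ.1) := fun v hv =>
      isCurve_smul h0 (div_ne_zero hv.1 h0) (by rw [inv_div]; exact hv.2)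
    let c : V → Curve := fun v => ⟨_, hcur v v.2⟩
    have hc : Continuous c := by
      refine Continuous.subtype_mk ?_ _
      fun_prop
    have hce : ∀ v, (c v).1 1 = v := fun v => div_mul_cancel₀ _ h0
    have hmem : γ.1 1 ∈ V := ⟨h0, by rw [div_self h0]; exact γ.one_notMem⟩
    have hγ : γ = c ⟨_, hmem⟩ := Subtype.ext <| by
      change γ.1 = (γ.1 1 / γ.1 1) • γ.1
      rw [div_self h0, one_smul]
    have := exists_chart hV c hc hce ?_ ⟨_, hmem⟩
    · rwa [← hγ] at this
    · intro v η hη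
      have hv1 : (c v).1 1 ≠ 0 := by rw [hce]; exact v.2.1
      have hev1 : Continuous fun x : Curve => x.1 1 := by fun_prop
      have hm : ∀ᶠ η' : Curve in 𝓝 η, η'.1 1 ∈ V := by
        refine hev1.continuousAt.eventually (hV.mem_nhds ?_)
        change η.1 1 ∈ _
        rw [end_eq hη, hce]; exact v.2
      filter_upwards [eventually_of_smul hv1 hη, hm] with η' h1 h2
      obtain ⟨h3, h4⟩ := h1
      refine ⟨h2, ?_⟩
      have : c ⟨_, h2⟩ = ⟨_, h3⟩ := Subtype.ext <| ContinuousMap.ext fun t => by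
        have := v.2.1
        change (η'.1 1 / γ.1 1) * γ.1 t =
          (η'.1 1 / (c v).1 1) * ((v / γ.1 1) * γ.1 t)
        rw [hce]
        field_simp
      rwa [this]

/-- The charts are the local inverses of the endpoint projection. -/
instance : ChartedSpace ℂ Surface where
  atlas := {e | Surface.proj = e}
  chartAt x := (Surface.isLocalHomeomorph_proj x).choose
  mem_chart_source x := (Surface.isLocalHomeomorph_proj x).choose_spec.1
  chart_mem_atlas x := (Surface.isLocalHomeomorph_proj x).choose_spec.2

/-- The transition maps are restrictions of the identity, so the surface is a Riemann surface. -/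
instance : IsManifold 𝓘(ℂ, ℂ) ω Surface := by
  refine isManifold_of_contDiffOn _ _ _ fun e e' he he' => ?_
  refine contDiffOn_id.congr fun z hz => ?_
  simp only [mfld_simps] at hz ⊢
  have h1 : (e : Surface → ℂ) = e' := Eq.trans (Eq.symm he) he'
  rw [← h1]
  exact e.right_inv hz.1

/-- The distinguished point over `0`: the class of the constant curve. -/
def Surface.origin : Surface := Surface.mk ⟨segMap 0, segMap_isCurve (by simp)⟩

/-- The points of the first sheet, reached by a straight segment from `0`. -/
def Surface.seg (w : ℂ) (h : w ∉ Complex.ofReal '' Ici (1 : ℝ)) : Surface :=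
  Surface.mk ⟨segMap w, segMap_isCurve h⟩

/-- The complete elliptic integral of the first kind as a function of the parameter
`m = k²`, in its principal branch on `ℂ ∖ [1, ∞)`. -/
def ellipticK (m : ℂ) : ℂ :=
  ∫ θ in (0 : ℝ)..(Real.pi / 2), (1 - m * (Real.sin θ : ℂ) ^ 2) ^ (-(1 / 2) : ℂ)

/-- `F t` is a germ at `γ t` for `t₀ ≤ t ≤ 1`, and `F` is the analytic continuation of the
germ of `f` at `γ t₀` along `γ`. -/
structure IsContinuation (γ : C(unitInterval, ℂ)) (t₀ : unitInterval) (f : ℂ → ℂ)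
    (F : unitInterval → ℂ → ℂ) : Prop where
  start : F t₀ =ᶠ[𝓝 (γ t₀)] f
  analytic : ∀ t, t₀ ≤ t → AnalyticAt ℂ (F t) (γ t)
  compat : ∀ t, t₀ ≤ t → ∀ᶠ s in 𝓝[Ici t₀] t, F s =ᶠ[𝓝 (γ s)] F t

/-- The open unit disc. -/
def disc : TopologicalSpace.Opens ℂ := ⟨Metric.ball 0 1, Metric.isOpen_ball⟩

end NomeSurface

end

open NomeSurface

/-!
As a function of the nome, `λ = z θ₂(z) ^ 4 / θ₃(z) ^ 4` vanishes only at the origin, omits `1`, and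
has nowhere vanishing derivative: by the duplication formulas of the theta constants, a zero of
`θ₂`, `θ₃` or `λ'` in the disc would propagate under `z ↦ ± z ^ 2` to a sequence of zeros tending to
`0`. With `z = exp (π i τ)`, it becomes the modular function on the upper half-plane, a covering of
`ℂ \ {0, 1}` which near `0` is a power series with derivative `16`. Hence an admissible curve,
starting at `0` and avoiding `0` and `1` afterwards, lifts uniquely to a curve in the disc starting
at `0`, and the endpoint of the lift depends only on the homotopy class. The disc being contractible
along rays, this identifies it with the surface of homotopy classes.

The nome formula comes from Landen's transformation: it gives `K = π / 2 * θ₃ ^ 2` for nomes near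
the origin, hence everywhere by continuation, while `τ ↦ -1 / τ` exchanges `λ` and `1 - λ`. Along a
lifted curve, `K(ω)` and `K(1 - ω)` are therefore continued by holomorphic functions of `τ` whose
quotient is `-i τ`.
-/

noncomputable section

namespace NomeSurface

/-! ### Theta constants as functions of the nome -/

section LacunarySeries

variable {e f : ℤ → ℕ} {z : ℂ}

/-- The power series whose exponents, with multiplicity, are the values of `e`; the theta constants
have this shape. -/
def lacunarySeries (e : ℤ → ℕ) (z : ℂ) : ℂ := ∑' n : ℤ, z ^ e n

theorem summable_pow_natAbs {r : ℝ} (hr₀ : 0 ≤ r) (hr₁ : r < 1) :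
    Summable fun n : ℤ => r ^ n.natAbs := by
  refine Summable.of_nat_of_neg ?_ ?_ <;> simpa using summable_geometric_of_lt_one hr₀ hr₁

theorem summable_pow_of_natAbs_le (he : ∀ n, n.natAbs ≤ e n + 1) {r : ℝ} (hr₀ : 0 ≤ r)
    (hr₁ : r < 1) : Summable fun n : ℤ => r ^ e n := by
  rcases hr₀.eq_or_lt with rfl | hr
  · refine summable_of_hasFiniteSupport ((Set.finite_Icc (-1 : ℤ) 1).subset fun n hn => ?_)
    have hen : e n = 0 := by
      by_contra h
      exact hn (zero_pow h)
    have := he n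
    constructor <;> omega
  · refine Summable.of_nonneg_of_le (fun n => by positivity) (fun n => ?_)
      ((summable_pow_natAbs hr₀ hr₁).mul_left r⁻¹)
    rw [inv_mul_eq_div, le_div_iff₀ hr, ← pow_succ]
    exact pow_le_pow_of_le_one hr₀ hr₁.le (he n)

theorem summable_norm_pow_of_natAbs_le (he : ∀ n, n.natAbs ≤ e n + 1) (hz : ‖z‖ < 1) :
    Summable fun n : ℤ => ‖z ^ e n‖ := by
  simpa only [norm_pow] using summable_pow_of_natAbs_le he (norm_nonneg z) hz

theorem differentiableAt_lacunarySeries (he : ∀ n, n.natAbs ≤ e n + 1) (hz : ‖z‖ < 1) :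
    DifferentiableAt ℂ (lacunarySeries e) z := by
  obtain ⟨r, hzr, hr₁⟩ := exists_between hz
  have hr₀ : 0 ≤ r := (norm_nonneg z).trans hzr.le
  have hdiff : DifferentiableOn ℂ (lacunarySeries e) (Metric.ball 0 r) := by
    refine Complex.differentiableOn_tsum_of_summable_norm (summable_pow_of_natAbs_le he hr₀ hr₁)
      (fun n => (differentiable_id.pow _).differentiableOn) Metric.isOpen_ball fun n w hw => ?_
    rw [norm_pow]
    exact pow_le_pow_left₀ (norm_nonneg w) (mem_ball_zero_iff.1 hw).le _
  exact hdiff.differentiableAt (Metric.isOpen_ball.mem_nhds (mem_ball_zero_iff.2 hzr))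

theorem hasSum_lacunarySeries_mul (he : ∀ n, n.natAbs ≤ e n + 1) (hf : ∀ n, n.natAbs ≤ f n + 1)
    (hz : ‖z‖ < 1) :
    HasSum (fun p : ℤ × ℤ => z ^ (e p.1 + f p.2)) (lacunarySeries e z * lacunarySeries f z) := by
  have hse := summable_norm_pow_of_natAbs_le he hz
  have hsf := summable_norm_pow_of_natAbs_le hf hz
  simp only [lacunarySeries, tsum_mul_tsum_of_summable_norm hse hsf, pow_add]
  exact (summable_mul_of_summable_norm hse hsf).hasSum

end LacunarySeries

section ThetaConstants

variable {z : ℂ}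

/-- The exponents `n²` of `θ₃`. -/
def squareExp (n : ℤ) : ℕ := n.natAbs ^ 2

/-- The exponents `n (n + 1)` of `q^(-1/4) θ₂`, which are nonnegative for every integer `n`. -/
def pronicExp (n : ℤ) : ℕ := (n * (n + 1)).toNat

theorem cast_squareExp (n : ℤ) : (squareExp n : ℤ) = n ^ 2 := by simp [squareExp]

theorem cast_pronicExp (n : ℤ) : (pronicExp n : ℤ) = n * (n + 1) := by
  refine Int.toNat_of_nonneg ?_
  rcases le_or_gt 0 n with h | h
  · positivity
  · nlinarith

theorem natAbs_le_squareExp (n : ℤ) : n.natAbs ≤ squareExp n + 1 := by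
  zify
  rw [cast_squareExp]
  rcases abs_cases n with h | h <;> nlinarith

theorem natAbs_le_pronicExp (n : ℤ) : n.natAbs ≤ pronicExp n + 1 := by
  zify
  rw [cast_pronicExp]
  rcases abs_cases n with h | h
  · nlinarith
  · nlinarith [sq_nonneg (n + 1)]

/-- The theta constant `θ₃` as a function of the nome. -/
def thetaThree (z : ℂ) : ℂ := lacunarySeries squareExp z

/-- The theta constant `θ₂` as a function of the nome `q`, without its factor `q^(1/4)`, which is
not single valued. -/
def thetaTwo (z : ℂ) : ℂ := lacunarySeries pronicExp z

theorem differentiableAt_thetaThree (hz : ‖z‖ < 1) : DifferentiableAt ℂ thetaThree z :=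
  differentiableAt_lacunarySeries natAbs_le_squareExp hz

theorem differentiableAt_thetaTwo (hz : ‖z‖ < 1) : DifferentiableAt ℂ thetaTwo z :=
  differentiableAt_lacunarySeries natAbs_le_pronicExp hz

theorem thetaThree_zero : thetaThree 0 = 1 := by
  rw [thetaThree, lacunarySeries, tsum_eq_single 0]
  · simp [squareExp]
  · intro n hn
    exact zero_pow (by simpa [squareExp] using hn)

theorem thetaTwo_zero : thetaTwo 0 = 2 := by
  have hvanish : ∀ n ∉ ({0, -1} : Finset ℤ), (0 : ℂ) ^ pronicExp n = 0 := by
    intro n hn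
    refine zero_pow fun h => hn ?_
    have hn' := cast_pronicExp n
    rw [h, Nat.cast_zero, eq_comm, mul_eq_zero] at hn'
    simp only [Finset.mem_insert, Finset.mem_singleton]
    omega
  rw [thetaTwo, lacunarySeries, tsum_eq_sum hvanish, Finset.sum_pair (by decide)]
  norm_num [pronicExp]

theorem thetaTwo_neg (z : ℂ) : thetaTwo (-z) = thetaTwo z := by
  refine tsum_congr fun n => Even.neg_pow ?_ z
  have := Int.even_mul_succ_self n
  rw [← cast_pronicExp n] at this
  exact_mod_cast this

/-- Pairs of integers, split according to the parity of their sum: the quadratic form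
`a ^ 2 + b ^ 2` doubles under `(a, b) ↦ (a + b, a - b)`. -/
def parityEquiv : (ℤ × ℤ) ⊕ (ℤ × ℤ) ≃ ℤ × ℤ where
  toFun := Sum.elim (fun p => (p.1 + p.2, p.1 - p.2)) fun p => (p.1 + p.2 + 1, p.1 - p.2)
  invFun p := if (p.1 + p.2) % 2 = 0 then Sum.inl ((p.1 + p.2) / 2, (p.1 - p.2) / 2)
    else Sum.inr ((p.1 + p.2 - 1) / 2, (p.1 - p.2 - 1) / 2)
  left_inv := by
    rintro (⟨a, b⟩ | ⟨a, b⟩)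
    · have h : (a + b + (a - b)) % 2 = 0 := by omega
      simp only [Sum.elim_inl, h, if_true]
      congr 2 <;> omega
    · have h : ¬ (a + b + 1 + (a - b)) % 2 = 0 := by omega
      simp only [Sum.elim_inr, h, if_false]
      congr 2 <;> omega
  right_inv := by
    rintro ⟨m, n⟩
    by_cases h : (m + n) % 2 = 0
    · simp only [h, if_true, Sum.elim_inl]
      ext <;> dsimp only <;> omega
    · simp only [h, if_false, Sum.elim_inr]
      ext <;> dsimp only <;> omega

theorem norm_sq_lt_one (hz : ‖z‖ < 1) : ‖z ^ 2‖ < 1 := by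
  rw [norm_pow]
  exact pow_lt_one₀ (norm_nonneg z) hz two_ne_zero

theorem thetaThree_sq (hz : ‖z‖ < 1) :
    thetaThree z ^ 2 = thetaThree (z ^ 2) ^ 2 + z * thetaTwo (z ^ 2) ^ 2 := by
  have hz₂ := norm_sq_lt_one hz
  have hsum := hasSum_lacunarySeries_mul natAbs_le_squareExp natAbs_le_squareExp hz
  have hthree := hasSum_lacunarySeries_mul natAbs_le_squareExp natAbs_le_squareExp hz₂
  have htwo :=
    (hasSum_lacunarySeries_mul natAbs_le_pronicExp natAbs_le_pronicExp hz₂).mul_left z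
  rw [← parityEquiv.hasSum_iff] at hsum
  simp only [thetaThree, thetaTwo, pow_two (lacunarySeries _ _)]
  refine hsum.unique (HasSum.sum (hthree.congr_fun ?_) (htwo.congr_fun ?_))
  all_goals
    rintro ⟨a, b⟩
    simp only [Function.comp_apply, parityEquiv, Equiv.coe_fn_mk, Sum.elim_inl, Sum.elim_inr,
      ← pow_mul, ← pow_succ']
    congr 1
    zify
    simp only [cast_squareExp, cast_pronicExp]
    ring

theorem thetaTwo_sq (hz : ‖z‖ < 1) :
    thetaTwo z ^ 2 = 2 * thetaTwo (z ^ 2) * thetaThree (z ^ 2) := by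
  have hz₂ := norm_sq_lt_one hz
  have hsum := hasSum_lacunarySeries_mul natAbs_le_pronicExp natAbs_le_pronicExp hz
  have heven := hasSum_lacunarySeries_mul natAbs_le_pronicExp natAbs_le_squareExp hz₂
  have hodd := hasSum_lacunarySeries_mul natAbs_le_squareExp natAbs_le_pronicExp hz₂
  rw [← parityEquiv.hasSum_iff] at hsum
  rw [← ((Equiv.addRight (1 : ℤ)).prodCongr (Equiv.refl ℤ)).hasSum_iff] at hodd
  rw [two_mul, add_mul]
  nth_rw 2 [mul_comm (thetaTwo (z ^ 2))]
  simp only [thetaThree, thetaTwo, pow_two (lacunarySeries _ _)]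
  refine hsum.unique (HasSum.sum (heven.congr_fun ?_) (hodd.congr_fun ?_))
  all_goals
    rintro ⟨a, b⟩
    simp only [Function.comp_apply, parityEquiv, Equiv.coe_fn_mk, Sum.elim_inl, Sum.elim_inr,
      ← pow_mul, Equiv.prodCongr_apply, Prod.map, Equiv.coe_addRight, Equiv.refl_apply]
    congr 1
    zify
    simp only [cast_squareExp, cast_pronicExp]
    ring

/-- Jacobi's identity `θ₃ ^ 4 = θ₄ ^ 4 + θ₂ ^ 4`, where `θ₄ q = θ₃ (-q)`. -/
theorem thetaThree_pow_four_sub (hz : ‖z‖ < 1) :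
    thetaThree z ^ 4 - thetaThree (-z) ^ 4 = z * thetaTwo z ^ 4 := by
  have hneg := thetaThree_sq (z := -z) (by simpa using hz)
  rw [neg_sq] at hneg
  calc thetaThree z ^ 4 - thetaThree (-z) ^ 4
      = (thetaThree z ^ 2) ^ 2 - (thetaThree (-z) ^ 2) ^ 2 := by ring
    _ = z * (2 * thetaTwo (z ^ 2) * thetaThree (z ^ 2)) ^ 2 := by
      rw [thetaThree_sq hz, hneg]; ring
    _ = z * thetaTwo z ^ 4 := by rw [← thetaTwo_sq hz]; ring

end ThetaConstants

section Nonvanishing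

variable {z : ℂ}

theorem ne_of_propagates_under_squaring {E F : Type*} [SeminormedAddCommGroup E]
    [TopologicalSpace F] [T1Space F] {g : E → F} {σ : E → E} {c : F}
    (hσ : ∀ x, ‖σ x‖ ≤ ‖x‖ ^ 2) (hg : ContinuousAt g 0) (hg₀ : g 0 ≠ c)
    (hprop : ∀ x, ‖x‖ < 1 → g x = c → g (σ x) = c) {x : E} (hx : ‖x‖ < 1) : g x ≠ c := by
  intro hgx
  have hnorm : ∀ n : ℕ, ‖σ^[n] x‖ ≤ ‖x‖ ^ 2 ^ n := by
    intro n
    induction n with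
    | zero => simp
    | succ n ih =>
      rw [Function.iterate_succ_apply', pow_succ, pow_mul]
      exact (hσ _).trans (pow_le_pow_left₀ (norm_nonneg _) ih 2)
  have hval : ∀ n : ℕ, g (σ^[n] x) = c := by
    intro n
    induction n with
    | zero => exact hgx
    | succ n ih =>
      rw [Function.iterate_succ_apply']
      exact hprop _ ((hnorm n).trans_lt (pow_lt_one₀ (norm_nonneg x) hx (by positivity))) ih
  have hlim : Tendsto (fun n : ℕ => σ^[n] x) atTop (𝓝 0) :=
    squeeze_zero_norm hnorm ((tendsto_pow_atTop_nhds_zero_of_lt_one (norm_nonneg x) hx).comp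
      (tendsto_pow_atTop_atTop_of_one_lt one_lt_two))
  have hconst := hg.tendsto.comp hlim
  simp only [Function.comp_def, hval, tendsto_const_nhds_iff] at hconst
  exact hg₀ hconst.symm

theorem thetaThree_ne_zero (hz : ‖z‖ < 1) : thetaThree z ≠ 0 := by
  refine ne_of_propagates_under_squaring (σ := fun z => -z ^ 2) (by simp)
    (differentiableAt_thetaThree (by simp)).continuousAt (by simp [thetaThree_zero])
    (fun z hz h => ?_) hz
  have hsq := thetaThree_sq hz
  have hjacobi := thetaThree_pow_four_sub (norm_sq_lt_one hz)
  rw [h] at hsq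
  have : thetaThree (-z ^ 2) ^ 4 = 0 := by
    linear_combination (thetaThree (z ^ 2) ^ 2 - z * thetaTwo (z ^ 2) ^ 2) * (-hsq) - hjacobi
  exact eq_zero_of_pow_eq_zero this

theorem thetaTwo_ne_zero (hz : ‖z‖ < 1) : thetaTwo z ≠ 0 := by
  refine ne_of_propagates_under_squaring (σ := fun z => z ^ 2) (by simp)
    (differentiableAt_thetaTwo (by simp)).continuousAt (by simp [thetaTwo_zero])
    (fun z hz h => ?_) hz
  have hsq := thetaTwo_sq hz
  rw [h] at hsq
  simpa [thetaThree_ne_zero (norm_sq_lt_one hz)] using hsq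

/-- The inverse nome: the modular function `λ` as a function of the nome. -/
def inverseNome (z : ℂ) : ℂ := z * thetaTwo z ^ 4 / thetaThree z ^ 4

@[simp] theorem inverseNome_zero : inverseNome 0 = 0 := by simp [inverseNome]

theorem one_sub_inverseNome (hz : ‖z‖ < 1) :
    1 - inverseNome z = thetaThree (-z) ^ 4 / thetaThree z ^ 4 := by
  rw [inverseNome, ← thetaThree_pow_four_sub hz, sub_div,
    div_self (pow_ne_zero _ (thetaThree_ne_zero hz)), sub_sub_cancel]

theorem inverseNome_ne_one (hz : ‖z‖ < 1) : inverseNome z ≠ 1 := by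
  have hz' : ‖-z‖ < 1 := by rwa [norm_neg]
  refine (sub_ne_zero.1 ?_).symm
  rw [one_sub_inverseNome hz]
  exact div_ne_zero (pow_ne_zero _ (thetaThree_ne_zero hz'))
    (pow_ne_zero _ (thetaThree_ne_zero hz))

theorem inverseNome_ne_zero (hz : ‖z‖ < 1) (hz₀ : z ≠ 0) : inverseNome z ≠ 0 :=
  div_ne_zero (mul_ne_zero hz₀ (pow_ne_zero _ (thetaTwo_ne_zero hz)))
    (pow_ne_zero _ (thetaThree_ne_zero hz))

theorem inverseNome_neg (hz : ‖z‖ < 1) :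
    inverseNome (-z) = inverseNome z / (inverseNome z - 1) := by
  have hpos := thetaThree_ne_zero hz
  have hneg := thetaThree_ne_zero (z := -z) (by rwa [norm_neg])
  rw [← neg_sub 1 (inverseNome z), one_sub_inverseNome hz, inverseNome, inverseNome, thetaTwo_neg]
  field_simp

theorem differentiableAt_inverseNome (hz : ‖z‖ < 1) : DifferentiableAt ℂ inverseNome z :=
  (differentiableAt_id.mul ((differentiableAt_thetaTwo hz).pow 4)).div
    ((differentiableAt_thetaThree hz).pow 4) (pow_ne_zero _ (thetaThree_ne_zero hz))

theorem analyticOnNhd_inverseNome : AnalyticOnNhd ℂ inverseNome (Metric.ball 0 1) :=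
  DifferentiableOn.analyticOnNhd (fun _ hz =>
    (differentiableAt_inverseNome (mem_ball_zero_iff.1 hz)).differentiableWithinAt)
    Metric.isOpen_ball

theorem hasDerivAt_inverseNome_zero : HasDerivAt inverseNome 16 0 := by
  have htwo := (differentiableAt_thetaTwo (z := 0) (by simp)).hasDerivAt
  have hthree := (differentiableAt_thetaThree (z := 0) (by simp)).hasDerivAt
  refine (((hasDerivAt_id (0 : ℂ)).mul (htwo.pow 4)).div (hthree.pow 4)
    (pow_ne_zero _ (thetaThree_ne_zero (by simp)))).congr_deriv ?_
  norm_num [thetaTwo_zero, thetaThree_zero]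

/-- The elliptic modulus `k = θ₂ ^ 2 / θ₃ ^ 2` belonging to the nome `z ^ 2`, so that
`k ^ 2 = inverseNome (z ^ 2)`. -/
def modulus (z : ℂ) : ℂ := z * thetaTwo (z ^ 2) ^ 2 / thetaThree (z ^ 2) ^ 2

theorem modulus_sq (z : ℂ) : modulus z ^ 2 = inverseNome (z ^ 2) := by
  rw [modulus, inverseNome]; ring

theorem thetaThree_sq_eq_modulus (hz : ‖z‖ < 1) :
    thetaThree z ^ 2 = (1 + modulus z) * thetaThree (z ^ 2) ^ 2 := by
  have := thetaThree_ne_zero (norm_sq_lt_one hz)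
  rw [thetaThree_sq hz, modulus]
  field_simp

theorem one_add_modulus_mul_one_sub_ne_zero (hz : ‖z‖ < 1) :
    (1 + modulus z) * (1 - modulus z) ≠ 0 := by
  rw [← sq_sub_sq, one_pow, modulus_sq]
  exact sub_ne_zero.2 (inverseNome_ne_one (norm_sq_lt_one hz)).symm

theorem inverseNome_eq_modulus (hz : ‖z‖ < 1) :
    inverseNome z = 4 * modulus z / (1 + modulus z) ^ 2 := by
  have hk := left_ne_zero_of_mul (one_add_modulus_mul_one_sub_ne_zero hz)
  have hθ := thetaThree_ne_zero (norm_sq_lt_one hz)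
  have hthree : thetaThree z ^ 4 = ((1 + modulus z) * thetaThree (z ^ 2) ^ 2) ^ 2 := by
    rw [← thetaThree_sq_eq_modulus hz]; ring
  have htwo : thetaTwo z ^ 4 = (2 * thetaTwo (z ^ 2) * thetaThree (z ^ 2)) ^ 2 := by
    rw [← thetaTwo_sq hz]; ring
  have hmod : modulus z * thetaThree (z ^ 2) ^ 2 = z * thetaTwo (z ^ 2) ^ 2 := by
    rw [modulus]; field_simp
  rw [inverseNome, hthree, htwo, div_eq_div_iff (by positivity) (by positivity)]
  linear_combination (-4) * thetaThree (z ^ 2) ^ 2 * (1 + modulus z) ^ 2 * hmod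

theorem differentiableAt_modulus (hz : ‖z‖ < 1) : DifferentiableAt ℂ modulus z := by
  have hz₂ := norm_sq_lt_one hz
  have hsq : DifferentiableAt ℂ (fun z : ℂ => z ^ 2) z := differentiableAt_id.pow 2
  exact (differentiableAt_id.mul (((differentiableAt_thetaTwo hz₂).comp z hsq).pow 2)).div
    (((differentiableAt_thetaThree hz₂).comp z hsq).pow 2)
    (pow_ne_zero _ (thetaThree_ne_zero hz₂))

theorem deriv_inverseNome_eq_modulus (hz : ‖z‖ < 1) :
    deriv inverseNome z = 4 * deriv modulus z * (1 - modulus z) / (1 + modulus z) ^ 3 := by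
  have hk := (differentiableAt_modulus hz).hasDerivAt
  have hp := left_ne_zero_of_mul (one_add_modulus_mul_one_sub_ne_zero hz)
  have hlanden : inverseNome =ᶠ[𝓝 z] fun w => 4 * modulus w / (1 + modulus w) ^ 2 := by
    filter_upwards [Metric.isOpen_ball.mem_nhds (mem_ball_zero_iff.2 hz)] with w hw
    exact inverseNome_eq_modulus (mem_ball_zero_iff.1 hw)
  refine ((((hk.const_mul 4).div ((hk.const_add 1).pow 2) (pow_ne_zero 2 hp)).congr_deriv
    ?_).congr_of_eventuallyEq hlanden).deriv
  simp only [Pi.pow_apply]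
  rw [div_eq_div_iff (pow_ne_zero _ (pow_ne_zero _ hp)) (pow_ne_zero _ hp)]
  push_cast
  ring

theorem deriv_inverseNome_sq_mul (hz : ‖z‖ < 1) :
    deriv inverseNome (z ^ 2) * (2 * z) = 2 * modulus z * deriv modulus z := by
  have hcomp :
      HasDerivAt (fun z => inverseNome (z ^ 2)) (deriv inverseNome (z ^ 2) * (2 * z)) z := by
    simpa [Function.comp_def] using
      (differentiableAt_inverseNome (norm_sq_lt_one hz)).hasDerivAt.comp z (hasDerivAt_pow 2 z)
  refine hcomp.unique ?_
  simp only [← modulus_sq]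
  simpa [Pi.pow_def] using (differentiableAt_modulus hz).hasDerivAt.pow 2

theorem deriv_inverseNome_ne_zero (hz : ‖z‖ < 1) : deriv inverseNome z ≠ 0 := by
  refine ne_of_propagates_under_squaring (σ := fun z => z ^ 2) (by simp)
    (analyticOnNhd_inverseNome 0 (by simp)).deriv.continuousAt
    (by simp [hasDerivAt_inverseNome_zero.deriv]) (fun z hz h => ?_) hz
  rcases eq_or_ne z 0 with rfl | hz₀
  · simpa using h
  obtain ⟨hp, hm⟩ := mul_ne_zero_iff.1 (one_add_modulus_mul_one_sub_ne_zero hz)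
  rw [deriv_inverseNome_eq_modulus hz] at h
  have hk : deriv modulus z = 0 := by simpa [hp, hm] using h
  simpa [hk, hz₀] using deriv_inverseNome_sq_mul hz

end Nonvanishing

/-! ### Coverings from compact fundamental domains -/

section LocalHomeomorph

variable {𝕜 : Type*} [NontriviallyNormedField 𝕜] [CompleteSpace 𝕜] {f f' : 𝕜 → 𝕜}

theorem isLocalHomeomorphOn_of_hasStrictDerivAt {s : Set 𝕜}
    (hf : ∀ z ∈ s, HasStrictDerivAt f (f' z) z) (hf' : ∀ z ∈ s, f' z ≠ 0) :
    IsLocalHomeomorphOn f s := fun z hz =>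
  ⟨((hf z hz).hasStrictFDerivAt_equiv (hf' z hz)).toOpenPartialHomeomorph f,
    HasStrictFDerivAt.mem_toOpenPartialHomeomorph_source _, rfl⟩

theorem isLocalHomeomorph_comp_of_hasStrictDerivAt {E : Type*} [TopologicalSpace E] {c : E → 𝕜}
    (hc : IsOpenEmbedding c) (hf : ∀ e, HasStrictDerivAt f (f' (c e)) (c e))
    (hf' : ∀ e, f' (c e) ≠ 0) : IsLocalHomeomorph (f ∘ c) := by
  rw [isLocalHomeomorph_iff_isLocalHomeomorphOn_univ]
  exact (isLocalHomeomorphOn_of_hasStrictDerivAt (s := range c) (forall_mem_range.2 hf)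
    (forall_mem_range.2 hf')).comp hc.isLocalHomeomorph.isLocalHomeomorphOn
    fun e _ => mem_range_self e

end LocalHomeomorph

section Covering

variable {E X : Type*} {f : E → X} {s t : X → E} {V W : Set X}

theorem preimage_inter_image_section (hfs : RightInvOn s f V) (hWV : W ⊆ V) :
    f ⁻¹' W ∩ s '' V = s '' W := by
  ext e
  constructor
  · rintro ⟨he, v, hv, rfl⟩
    exact ⟨v, by rwa [mem_preimage, hfs hv] at he, rfl⟩
  · rintro ⟨v, hv, rfl⟩
    exact ⟨by rwa [mem_preimage, hfs (hWV hv)], v, hWV hv, rfl⟩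

variable [TopologicalSpace E] [TopologicalSpace X]

theorem isOpen_image_section_iff (hf : IsLocalHomeomorph f) (hV : IsOpen V)
    (hs : ContinuousOn s V) (hfs : RightInvOn s f V) (hWV : W ⊆ V) :
    IsOpen (s '' W) ↔ IsOpen W := by
  constructor
  · intro hW
    have := hf.isOpenMap _ hW
    rwa [image_image, image_congr fun v hv => hfs (hWV hv), image_id'] at this
  · intro hW
    have hcomp : IsOpenEmbedding (f ∘ V.domRestrict s) := by
      rw [show f ∘ V.domRestrict s = Subtype.val from funext fun v => hfs v.2]
      exact hV.isOpenEmbedding_subtypeVal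
    have := (hf.isOpenEmbedding_of_comp hcomp
      (continuousOn_iff_continuous_domRestrict.1 hs)).isOpenMap _
      (hW.preimage continuous_subtype_val)
    rwa [domRestrict_eq, image_comp, Subtype.image_preimage_coe, inter_eq_right.2 hWV] at this

theorem eqOn_of_sections [T2Space E] (hf : IsLocalHomeomorph f) (hV : IsPreconnected V)
    (hs : ContinuousOn s V) (hfs : RightInvOn s f V) (ht : ContinuousOn t V)
    (hft : RightInvOn t f V) {v : X} (hv : v ∈ V) (hst : s v = t v) : EqOn s t V :=
  (T2Space.isSeparatedMap f).eqOn_of_comp_eqOn hf.isLocallyInjective hV hs ht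
    (fun _ hw => (hfs hw).trans (hft hw).symm) hv hst

/-- Over `V` there is a continuous section of `f` through the point `e` of the total space; used for
points `e` with `f e ∈ V`. -/
def HasSectionThrough (f : E → X) (V : Set X) (e : E) : Prop :=
  ∃ s : X → E, ContinuousOn s V ∧ RightInvOn s f V ∧ s (f e) = e

theorem HasSectionThrough.mono {e : E} (h : HasSectionThrough f V e) (hWV : W ⊆ V) :
    HasSectionThrough f W e := by
  obtain ⟨s, hs, hfs, hse⟩ := h
  exact ⟨s, hs.mono hWV, hfs.mono hWV, hse⟩

theorem HasSectionThrough.of_semiconj {g : E ≃ₜ E} {h : X ≃ₜ X} {e : E}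
    (hgh : Function.Semiconj f g h) (hge : HasSectionThrough f V (g e)) :
    HasSectionThrough f (h ⁻¹' V) e := by
  obtain ⟨s, hs, hfs, hse⟩ := hge
  refine ⟨g.symm ∘ s ∘ h, g.symm.continuous.comp_continuousOn
    (hs.comp h.continuous.continuousOn fun _ => id), fun v hv => h.injective ?_, ?_⟩
  · rw [← hgh, Function.comp_apply, g.apply_symm_apply]
    exact hfs hv
  · rw [Function.comp_apply, Function.comp_apply, ← hgh, hse, g.symm_apply_apply]

theorem isEvenlyCovered_of_hasSectionThrough [T2Space E] (hf : IsLocalHomeomorph f)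
    (hV : IsOpen V) (hVc : IsPreconnected V) {x : X} (hx : x ∈ V)
    (h : ∀ e, f e ∈ V → HasSectionThrough f V e) : IsEvenlyCovered f x (f ⁻¹' {x}) := by
  have hdiscrete : DiscreteTopology (f ⁻¹' {x}) :=
    (IsDiscrete.of_openPartialHomeomorph f subset_rfl fun e _ => by
      obtain ⟨φ, he, hφ⟩ := hf e
      exact ⟨φ, he, hφ.symm⟩).1
  rcases isEmpty_or_nonempty (f ⁻¹' {x}) with hempty | hnonempty
  · refine .of_preimage_eq_empty _ (hV.mem_nhds hx) (eq_empty_of_forall_notMem fun e he => ?_)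
    obtain ⟨s, -, hfs, -⟩ := h e he
    exact hempty.false ⟨s x, hfs hx⟩
  have : Nonempty E := hnonempty.map Subtype.val
  choose s hs hfs hse using fun i : f ⁻¹' {x} => h i.1 (by rwa [show f i = x from i.2])
  have hsx : ∀ i, s i x = i := fun i => by simpa only [show f i = x from i.2] using hse i
  refine .of_trivialization (t := hV.trivializationDiscrete (fun i => s i '' V) V
    (fun i W hW => ?_) (fun i => ?_) (fun i v hv => ⟨s i v, ⟨v, hv, rfl⟩, hfs i hv⟩)
    (fun i j hij => disjoint_left.2 ?_) fun e he => ?_) hx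
  · rw [preimage_inter_image_section (hfs i) hW, isOpen_image_section_iff hf hV (hs i) (hfs i) hW]
  · rintro _ ⟨v, hv, rfl⟩ _ ⟨w, hw, rfl⟩ hvw
    rw [hfs i hv, hfs i hw] at hvw
    rw [hvw]
  · rintro _ ⟨v, hv, rfl⟩ ⟨w, hw, hwv⟩
    obtain rfl : v = w := by rw [← hfs i hv, ← hwv, hfs j hw]
    have := eqOn_of_sections hf hVc (hs i) (hfs i) (hs j) (hfs j) hv hwv.symm hx
    exact hij (Subtype.ext (by rwa [hsx, hsx] at this))
  · obtain ⟨t, ht, hft, hte⟩ := h e he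
    refine mem_iUnion.2 ⟨⟨t x, hft hx⟩, f e, he, ?_⟩
    rw [eqOn_of_sections hf hVc (hs _) (hfs _) ht hft hx (hsx _) he, hte]

theorem exists_nhds_forall_hasSectionThrough [T2Space X] (hf : IsLocalHomeomorph f) {K : Set E}
    (hK : IsCompact K) (x : X) :
    ∃ V ∈ 𝓝 x, ∀ e ∈ K, f e ∈ V → HasSectionThrough f V e := by
  refine hK.induction_on (p := fun S => ∃ V ∈ 𝓝 x, ∀ e ∈ S, f e ∈ V → HasSectionThrough f V e)
    ⟨univ, univ_mem, by simp⟩ ?_ ?_ fun e _ => ?_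
  · rintro S T hST ⟨V, hV, h⟩
    exact ⟨V, hV, fun e he => h e (hST he)⟩
  · rintro S T ⟨V, hV, hS⟩ ⟨W, hW, hT⟩
    refine ⟨V ∩ W, inter_mem hV hW, ?_⟩
    rintro e (he | he) ⟨heV, heW⟩
    · exact (hS e he heV).mono inter_subset_left
    · exact (hT e he heW).mono inter_subset_right
  · rcases eq_or_ne (f e) x with rfl | hex
    · obtain ⟨φ, he, rfl⟩ := hf e
      exact ⟨φ.source, mem_nhdsWithin_of_mem_nhds (φ.open_source.mem_nhds he), φ.target,
        φ.open_target.mem_nhds (φ.map_source he), fun e' he' _ =>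
          ⟨φ.symm, φ.continuousOn_symm, fun _ => φ.right_inv, φ.left_inv he'⟩⟩
    · obtain ⟨U, V, hU, hV, heU, hxV, hUV⟩ := t2_separation hex
      exact ⟨f ⁻¹' U, mem_nhdsWithin_of_mem_nhds ((hU.preimage hf.continuous).mem_nhds heU), V,
        hV.mem_nhds hxV, fun e' he' heV => (disjoint_left.1 hUV he' heV).elim⟩

theorem isCoveringMap_of_compact_fundamental_domain [T2Space E] [T2Space X]
    [LocallyConnectedSpace X] (hf : IsLocalHomeomorph f) {H : Set (X ≃ₜ X)} (hH : H.Finite)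
    (hK : ∀ x, ∃ K : Set E, IsCompact K ∧ ∀ᶠ y in 𝓝 x, ∀ e, f e = y →
      ∃ g : E ≃ₜ E, ∃ h ∈ H, Function.Semiconj f g h ∧ g e ∈ K) : IsCoveringMap f := by
  intro x
  obtain ⟨K, hKc, hKx⟩ := hK x
  choose V hVx hV using fun h : X ≃ₜ X => exists_nhds_forall_hasSectionThrough hf hKc (h x)
  have hVH : ∀ᶠ y in 𝓝 x, ∀ h ∈ H, h y ∈ V h :=
    (Filter.eventually_all_finite hH).2 fun h _ => h.continuous.continuousAt (hVx h)
  obtain ⟨U, hU, hUo, hxU, hUc⟩ :=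
    locallyConnectedSpace_iff_subsets_isOpen_isConnected.1 ‹_› x _ (hKx.and hVH)
  refine isEvenlyCovered_of_hasSectionThrough hf hUo hUc.isPreconnected hxU fun e he => ?_
  obtain ⟨g, h, hh, hgh, hgK⟩ := (hU he).1 e rfl
  have hge : f (g e) ∈ V h := by
    rw [hgh]
    exact (hU he).2 h hh
  exact ((hV h _ hgK hge).of_semiconj hgh).mono fun v hv => (hU hv).2 h hh

end Covering

/-! ### The modular function -/

section Nome

open scoped UpperHalfPlane

variable {τ : ℂ}

/-- The nome `e^{iπτ}` of the period ratio `τ`. -/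
def nome (τ : ℂ) : ℂ := Complex.exp (Real.pi * Complex.I * τ)

theorem nome_I : nome Complex.I = Real.exp (-Real.pi) := by
  rw [nome, mul_assoc, Complex.I_mul_I, mul_neg_one, Complex.ofReal_exp, Complex.ofReal_neg]

theorem norm_nome (τ : ℂ) : ‖nome τ‖ = Real.exp (-(Real.pi * τ.im)) := by
  rw [nome, Complex.norm_exp]
  congr 1
  simp

theorem norm_nome_lt_one (hτ : 0 < τ.im) : ‖nome τ‖ < 1 := by
  rw [norm_nome, Real.exp_lt_one_iff]
  exact neg_neg_of_pos (mul_pos Real.pi_pos hτ)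

theorem nome_ne_zero (τ : ℂ) : nome τ ≠ 0 := Complex.exp_ne_zero _

theorem nome_pow (τ : ℂ) (n : ℕ) : nome τ ^ n = Complex.exp (Real.pi * Complex.I * n * τ) := by
  rw [nome, ← Complex.exp_nat_mul]
  congr 1
  ring

theorem nome_add_one (τ : ℂ) : nome (τ + 1) = -nome τ := by
  rw [nome, mul_add, mul_one, Complex.exp_add, Complex.exp_pi_mul_I, mul_neg_one, nome]

theorem hasDerivAt_nome (τ : ℂ) : HasDerivAt nome (Real.pi * Complex.I * nome τ) τ := by
  refine ((hasDerivAt_id τ).const_mul (Real.pi * Complex.I)).cexp.congr_deriv ?_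
  simp [nome, mul_comm]

theorem thetaThree_nome (τ : ℂ) : thetaThree (nome τ) = jacobiTheta₂ 0 τ := by
  refine tsum_congr fun n => ?_
  have hexp : (squareExp n : ℂ) = (n : ℂ) ^ 2 := by exact_mod_cast cast_squareExp n
  rw [nome_pow, jacobiTheta₂_term, hexp]
  congr 1
  ring

theorem thetaTwo_nome (τ : ℂ) : thetaTwo (nome τ) = jacobiTheta₂ (τ / 2) τ := by
  refine tsum_congr fun n => ?_
  have hexp : (pronicExp n : ℂ) = n * (n + 1) := by exact_mod_cast cast_pronicExp n
  rw [nome_pow, jacobiTheta₂_term, hexp]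
  congr 1
  ring

theorem thetaThree_neg_nome (τ : ℂ) : thetaThree (-nome τ) = jacobiTheta₂ (1 / 2) τ := by
  rw [← nome_add_one, thetaThree_nome]
  refine tsum_congr fun n => ?_
  rw [jacobiTheta₂_term, jacobiTheta₂_term, Complex.exp_eq_exp_iff_exists_int]
  obtain ⟨m, hm⟩ := Int.even_mul_pred_self n
  refine ⟨m, ?_⟩
  have hm' : (n : ℂ) * (n - 1) = m + m := by exact_mod_cast hm
  linear_combination Real.pi * Complex.I * hm'

theorem neg_I_mul_ne_zero (τ : ℍ) : -Complex.I * (τ : ℂ) ≠ 0 := mul_ne_zero (by simp) τ.ne_zero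

theorem thetaThree_nome_neg_inv_sq (τ : ℍ) :
    thetaThree (nome (-1 / τ)) ^ 2 = -Complex.I * τ * thetaThree (nome τ) ^ 2 := by
  have hroot : ((-Complex.I * (τ : ℂ)) ^ (1 / 2 : ℂ)) ^ 2 = -Complex.I * τ := by
    rw [← Complex.cpow_nat_mul]
    simp
  rw [thetaThree_nome, thetaThree_nome, jacobiTheta₂_functional_equation 0 τ, mul_pow, mul_pow,
    div_pow, hroot, one_pow, ← mul_assoc, ← mul_assoc, mul_one_div_cancel (neg_I_mul_ne_zero τ)]
  simp

theorem inverseNome_nome_neg_inv (τ : ℍ) :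
    inverseNome (nome (-1 / τ)) = 1 - inverseNome (nome τ) := by
  have hroot : (-Complex.I * (τ : ℂ)) ^ (1 / 2 : ℂ) ≠ 0 :=
    Complex.cpow_ne_zero_iff.2 (Or.inl (neg_I_mul_ne_zero τ))
  have hnome : Complex.exp (-Real.pi * Complex.I * (1 / 2) ^ 2 / τ) ^ 4 = nome (-1 / τ) := by
    rw [nome, ← Complex.exp_nat_mul]
    congr 1
    push_cast
    ring
  rw [one_sub_inverseNome (norm_nome_lt_one τ.2), thetaThree_nome τ, thetaThree_neg_nome,
    jacobiTheta₂_functional_equation 0 τ, jacobiTheta₂_functional_equation (1 / 2) τ, inverseNome,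
    thetaTwo_nome, thetaThree_nome, show (1 / 2 : ℂ) / τ = -(-1 / τ / 2) by ring,
    jacobiTheta₂_neg_left, zero_div]
  simp only [mul_pow, hnome]
  rw [mul_assoc, mul_assoc, mul_div_mul_left _ _ (pow_ne_zero 4 (one_div_ne_zero hroot))]
  simp

end Nome

section AnharmonicGroup

theorem finite_closure_pair_of_braid {G : Type*} [Group G] {s t : G} (hs : s * s = 1)
    (ht : t * t = 1) (hst : s * t * s = t * s * t) : (Subgroup.closure {s, t} : Set G).Finite := by
  have hss : ∀ x, s * (s * x) = x := fun x => by rw [← mul_assoc, hs, one_mul]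
  have htt : ∀ x, t * (t * x) = x := fun x => by rw [← mul_assoc, ht, one_mul]
  have htst : t * (s * t) = s * (t * s) := by simpa only [mul_assoc] using hst.symm
  have htsts : t * (s * (t * s)) = s * t := by rw [← htst, htt]
  refine (Set.toFinite {1, s, t, s * t, t * s, s * (t * s)}).subset fun g hg => ?_
  induction hg using Subgroup.closure_induction_left with
  | one => simp
  | mul_left x hx y _ ih =>
    rcases hx with rfl | rfl <;> rcases ih with rfl | rfl | rfl | rfl | rfl | rfl <;> simp [*]
  | inv_mul_cancel x hx y _ ih =>
    rcases hx with rfl | rfl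
    · rw [inv_eq_of_mul_eq_one_left hs]
      rcases ih with rfl | rfl | rfl | rfl | rfl | rfl <;> simp [*]
    · rw [inv_eq_of_mul_eq_one_left ht]
      rcases ih with rfl | rfl | rfl | rfl | rfl | rfl <;> simp [*]

theorem exists_mem_of_mem_closure_of_smul {G E X : Type*} [Group G] [MulAction G E]
    [TopologicalSpace X] {f : E → X} {S : Set G} {H : Subgroup (X ≃ₜ X)}
    (hS : ∀ g ∈ S, ∃ h ∈ H, ∀ e, f (g • e) = h (f e)) {g : G} (hg : g ∈ Subgroup.closure S) :
    ∃ h ∈ H, ∀ e, f (g • e) = h (f e) := by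
  induction hg using Subgroup.closure_induction with
  | mem g hg => exact hS g hg
  | one => exact ⟨1, H.one_mem, fun e => by rw [one_smul]; rfl⟩
  | mul g₁ g₂ _ _ ih₁ ih₂ =>
    obtain ⟨h₁, hh₁, hgh₁⟩ := ih₁
    obtain ⟨h₂, hh₂, hgh₂⟩ := ih₂
    exact ⟨h₁ * h₂, H.mul_mem hh₁ hh₂, fun e => by
      rw [mul_smul, hgh₁, hgh₂, Homeomorph.mul_apply]⟩
  | inv g _ ih =>
    obtain ⟨h, hh, hgh⟩ := ih
    refine ⟨h⁻¹, H.inv_mem hh, fun e => h.injective ?_⟩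
    rw [← hgh, smul_inv_smul, ← Homeomorph.mul_apply, mul_inv_cancel, Homeomorph.one_apply]

/-- The plane punctured at `0` and `1`, in which the modular function takes its values. -/
abbrev TwicePuncturedPlane : Type := {w : ℂ // w ≠ 0 ∧ w ≠ 1}

namespace TwicePuncturedPlane

theorem isOpen : IsOpen {w : ℂ | w ≠ 0 ∧ w ≠ 1} := isOpen_ne.inter isOpen_ne

instance : LocallyConnectedSpace TwicePuncturedPlane :=
  isOpen.isOpenEmbedding_subtypeVal.locallyConnectedSpace

/-- The symmetry `w ↦ 1 - w` of the twice punctured plane. -/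
def oneSub : TwicePuncturedPlane ≃ₜ TwicePuncturedPlane where
  toEquiv := Function.Involutive.toPerm
    (fun w => ⟨1 - w, sub_ne_zero.2 w.2.2.symm, fun h => w.2.1 (sub_eq_self.1 h)⟩)
    fun w => Subtype.ext (sub_sub_cancel 1 w.1)
  continuous_toFun := (continuous_const.sub continuous_subtype_val).subtype_mk _
  continuous_invFun := (continuous_const.sub continuous_subtype_val).subtype_mk _

/-- The symmetry `w ↦ w / (w - 1)` of the twice punctured plane. -/
def divSubOne : TwicePuncturedPlane ≃ₜ TwicePuncturedPlane :=
  have hcont : Continuous fun w : TwicePuncturedPlane => (w : ℂ) / (w - 1) :=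
    continuous_subtype_val.div₀ (continuous_subtype_val.sub continuous_const) fun w =>
      sub_ne_zero.2 w.2.2
  { toEquiv := Function.Involutive.toPerm
      (fun w => ⟨w / (w - 1), div_ne_zero w.2.1 (sub_ne_zero.2 w.2.2), fun h => by
        rw [div_eq_one_iff_eq (sub_ne_zero.2 w.2.2)] at h
        exact one_ne_zero (sub_eq_self.1 h.symm)⟩)
      fun w => Subtype.ext <| by
        have hw := sub_ne_zero.2 w.2.2
        change (w : ℂ) / (w - 1) / (w / (w - 1) - 1) = w
        rw [div_sub_one hw, sub_sub_cancel, div_div_div_cancel_right₀ hw, div_one]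
    continuous_toFun := hcont.subtype_mk _
    continuous_invFun := hcont.subtype_mk _ }

@[simp] theorem coe_oneSub (w : TwicePuncturedPlane) : (oneSub w : ℂ) = 1 - w := rfl

@[simp] theorem coe_divSubOne (w : TwicePuncturedPlane) : (divSubOne w : ℂ) = w / (w - 1) := rfl

/-- The anharmonic group of homeomorphisms of the twice punctured plane, isomorphic to the symmetric
group of the punctures `0`, `1` and `∞`. -/
def anharmonicGroup : Subgroup (TwicePuncturedPlane ≃ₜ TwicePuncturedPlane) :=
  Subgroup.closure {oneSub, divSubOne}

theorem finite_anharmonicGroup :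
    (anharmonicGroup : Set (TwicePuncturedPlane ≃ₜ TwicePuncturedPlane)).Finite := by
  refine finite_closure_pair_of_braid (Homeomorph.ext fun w => oneSub.symm_apply_apply w)
    (Homeomorph.ext fun w => divSubOne.symm_apply_apply w)
    (Homeomorph.ext fun w => Subtype.ext ?_)
  have hw₀ := w.2.1
  have hw₁ := sub_ne_zero.2 w.2.2
  simp only [Homeomorph.mul_apply, coe_oneSub, coe_divSubOne]
  have hone_sub : 1 - (w : ℂ) / (w - 1) = -1 / (w - 1) := by
    field_simp
    ring
  have hdiv_sub : -1 / ((w : ℂ) - 1) - 1 = -w / (w - 1) := by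
    field_simp
    ring
  rw [hone_sub, hdiv_sub, sub_sub_cancel_left]
  field_simp
  ring

end TwicePuncturedPlane

end AnharmonicGroup

section ModularFunction

open scoped UpperHalfPlane Modular MatrixGroups

/-- The modular function `λ` on the upper half-plane. -/
def modularLambda (τ : ℍ) : TwicePuncturedPlane :=
  ⟨inverseNome (nome τ), inverseNome_ne_zero (norm_nome_lt_one τ.2) (nome_ne_zero τ),
    inverseNome_ne_one (norm_nome_lt_one τ.2)⟩

theorem modularLambda_S_smul (τ : ℍ) :
    modularLambda (ModularGroup.S • τ) = (modularLambda τ).oneSub := by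
  refine Subtype.ext ((congrArg (fun σ => inverseNome (nome σ)) ?_).trans
    (inverseNome_nome_neg_inv τ))
  rw [UpperHalfPlane.modular_S_smul, UpperHalfPlane.coe_mk, inv_neg, neg_div, one_div]

theorem modularLambda_T_smul (τ : ℍ) :
    modularLambda (ModularGroup.T • τ) = (modularLambda τ).divSubOne := by
  refine Subtype.ext ((congrArg inverseNome ?_).trans (inverseNome_neg (norm_nome_lt_one τ.2)))
  rw [UpperHalfPlane.modular_T_smul, UpperHalfPlane.coe_vadd, Complex.ofReal_one, add_comm,
    nome_add_one]

theorem exists_anharmonic_modularLambda_smul (g : SL(2, ℤ)) :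
    ∃ h ∈ TwicePuncturedPlane.anharmonicGroup,
      ∀ τ : ℍ, modularLambda (g • τ) = h (modularLambda τ) := by
  refine exists_mem_of_mem_closure_of_smul (S := {ModularGroup.S, ModularGroup.T}) ?_
    (by simp [SpecialLinearGroup.SL2Z_generators])
  rintro g (rfl | rfl)
  · exact ⟨_, Subgroup.subset_closure (by simp), modularLambda_S_smul⟩
  · exact ⟨_, Subgroup.subset_closure (by simp), modularLambda_T_smul⟩

theorem analyticAt_inverseNome_nome {τ : ℂ} (hτ : 0 < τ.im) :
    AnalyticAt ℂ (inverseNome ∘ nome) τ :=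
  (analyticOnNhd_inverseNome _ (mem_ball_zero_iff.2 (norm_nome_lt_one hτ))).comp
    (Differentiable.analyticAt (fun σ => (hasDerivAt_nome σ).differentiableAt) τ)

theorem deriv_inverseNome_nome_ne_zero {τ : ℂ} (hτ : 0 < τ.im) :
    deriv (inverseNome ∘ nome) τ ≠ 0 := by
  have hq := norm_nome_lt_one hτ
  rw [((differentiableAt_inverseNome hq).hasDerivAt.comp τ (hasDerivAt_nome τ)).deriv]
  exact mul_ne_zero (deriv_inverseNome_ne_zero hq)
    (mul_ne_zero (mul_ne_zero (by simp) Complex.I_ne_zero) (nome_ne_zero τ))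

theorem isLocalHomeomorph_modularLambda : IsLocalHomeomorph modularLambda := by
  have hcoe : IsLocalHomeomorph ((Subtype.val : TwicePuncturedPlane → ℂ) ∘ modularLambda) :=
    isLocalHomeomorph_comp_of_hasStrictDerivAt UpperHalfPlane.isOpenEmbedding_coe
      (fun τ => (analyticAt_inverseNome_nome τ.2).hasStrictDerivAt)
      fun τ => deriv_inverseNome_nome_ne_zero τ.2
  exact hcoe.of_comp TwicePuncturedPlane.isOpen.isOpenEmbedding_subtypeVal.isLocalHomeomorph
    (continuous_induced_rng.2 hcoe.continuous)

theorem exists_norm_modularLambda_lt {c : ℝ} (hc : 0 < c) :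
    ∃ Y : ℝ, ∀ τ : ℍ, Y < τ.im → ‖(modularLambda τ : ℂ)‖ < c := by
  have hsmall : ∀ᶠ z in 𝓝 (0 : ℂ), ‖inverseNome z‖ < c :=
    hasDerivAt_inverseNome_zero.continuousAt.norm.eventually (gt_mem_nhds (by simpa using hc))
  obtain ⟨r, hr, hball⟩ := Metric.eventually_nhds_iff.1 hsmall
  refine ⟨-Real.log r / Real.pi, fun τ hτ => hball ?_⟩
  rw [div_lt_iff₀' Real.pi_pos] at hτ
  rw [dist_zero_right, norm_nome, ← Real.lt_log_iff_exp_lt hr]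
  exact neg_lt.1 hτ

theorem exists_forall_anharmonic_norm_gt (w : TwicePuncturedPlane) :
    ∃ c > 0, ∀ᶠ v in 𝓝 w, ∀ h ∈ TwicePuncturedPlane.anharmonicGroup, c < ‖(h v : ℂ)‖ := by
  have hfin := TwicePuncturedPlane.finite_anharmonicGroup
  have hw : ∀ᶠ c in 𝓝[>] (0 : ℝ), ∀ h ∈ TwicePuncturedPlane.anharmonicGroup, c < ‖(h w : ℂ)‖ :=
    (Filter.eventually_all_finite hfin).2 fun h _ =>
      mem_nhdsWithin_of_mem_nhds (gt_mem_nhds (norm_pos_iff.2 (h w).2.1))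
  obtain ⟨c, hc, hc₀⟩ := (hw.and self_mem_nhdsWithin).exists
  refine ⟨c, hc₀, (Filter.eventually_all_finite hfin).2 fun h hh => ?_⟩
  exact (continuous_subtype_val.comp h.continuous).norm.continuousAt.eventually
    (lt_mem_nhds (hc h hh))

theorem isCoveringMap_modularLambda : IsCoveringMap modularLambda := by
  refine isCoveringMap_of_compact_fundamental_domain isLocalHomeomorph_modularLambda
    TwicePuncturedPlane.finite_anharmonicGroup fun w => ?_
  obtain ⟨c, hc, hcw⟩ := exists_forall_anharmonic_norm_gt w
  obtain ⟨Y, hY⟩ := exists_norm_modularLambda_lt hc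
  refine ⟨_, ModularGroup.isCompact_truncatedFundamentalDomain Y, hcw.mono ?_⟩
  rintro _ hv τ rfl
  obtain ⟨g, hg⟩ := ModularGroup.exists_smul_mem_fd τ
  obtain ⟨h, hh, hgh⟩ := exists_anharmonic_modularLambda_smul g
  refine ⟨Homeomorph.smul (g : GL (Fin 2) ℝ), h, hh, hgh, hg, not_lt.1 fun him => ?_⟩
  have hsmall : ‖(modularLambda (g • τ) : ℂ)‖ < c := hY (g • τ) him
  rw [hgh] at hsmall
  exact (hsmall.trans (hv h hh)).false

end ModularFunction

/-! ### The complete elliptic integral -/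

section EllipticIntegral

variable {m : ℂ}

open scoped ComplexOrder in
theorem one_sub_mem_slitPlane_iff :
    1 - m ∈ Complex.slitPlane ↔ m ∉ Complex.ofReal '' Ici (1 : ℝ) := by
  rw [Complex.mem_slitPlane_iff_not_le_zero, sub_nonpos, Complex.le_def]
  refine not_congr ⟨fun hm => ⟨m.re, hm.1, Complex.ext rfl hm.2⟩, ?_⟩
  rintro ⟨x, hx, rfl⟩
  exact ⟨hx, rfl⟩

theorem one_sub_mul_sin_sq_mem_slitPlane (hm : m ∉ Complex.ofReal '' Ici (1 : ℝ)) (θ : ℝ) :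
    1 - m * (Real.sin θ : ℂ) ^ 2 ∈ Complex.slitPlane := by
  have hconv := Complex.starConvex_one_slitPlane (one_sub_mem_slitPlane_iff.2 hm)
    (sub_nonneg.2 (Real.sin_sq_le_one θ)) (sq_nonneg (Real.sin θ)) (sub_add_cancel 1 _)
  convert hconv using 1
  simp only [Complex.real_smul, Complex.ofReal_sub, Complex.ofReal_one, Complex.ofReal_pow]
  ring

theorem isOpen_compl_ofReal_image_Ici (a : ℝ) : IsOpen (Complex.ofReal '' Ici a)ᶜ :=
  (Complex.isometry_ofReal.isClosedEmbedding.isClosedMap _ isClosed_Ici).isOpen_compl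

theorem continuousOn_one_sub_mul_sin_sq_cpow (c : ℂ) : ContinuousOn
    (fun x : ℂ × ℝ => (1 - x.1 * (Real.sin x.2 : ℂ) ^ 2) ^ c)
    ((Complex.ofReal '' Ici (1 : ℝ))ᶜ ×ˢ univ) := by
  refine ContinuousOn.cpow_const ?_ fun x hx => one_sub_mul_sin_sq_mem_slitPlane hx.1 x.2
  fun_prop

theorem continuous_one_sub_mul_sin_sq_cpow (c : ℂ) (hm : m ∉ Complex.ofReal '' Ici (1 : ℝ)) :
    Continuous fun θ : ℝ => (1 - m * (Real.sin θ : ℂ) ^ 2) ^ c :=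
  (continuousOn_one_sub_mul_sin_sq_cpow c).comp_continuous (f := fun θ : ℝ => (m, θ))
    (by fun_prop) fun _ => ⟨hm, mem_univ _⟩

theorem hasDerivAt_one_sub_mul_sin_sq_cpow (hm : m ∉ Complex.ofReal '' Ici (1 : ℝ)) (θ : ℝ)
    (c : ℂ) : HasDerivAt (fun m : ℂ => (1 - m * (Real.sin θ : ℂ) ^ 2) ^ c)
      ((1 - m * (Real.sin θ : ℂ) ^ 2) ^ (c - 1) * (-c * (Real.sin θ : ℂ) ^ 2)) m := by
  have hlin : HasDerivAt (fun m : ℂ => 1 - m * (Real.sin θ : ℂ) ^ 2)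
      (-(1 * (Real.sin θ : ℂ) ^ 2)) m := ((hasDerivAt_id m).mul_const _).const_sub 1
  refine (hlin.cpow_const (one_sub_mul_sin_sq_mem_slitPlane hm θ)).congr_deriv ?_
  ring

theorem differentiableAt_ellipticK (hm : m ∉ Complex.ofReal '' Ici (1 : ℝ)) :
    DifferentiableAt ℂ ellipticK m := by
  obtain ⟨r, hr, hball⟩ :=
    Metric.nhds_basis_closedBall.mem_iff.1 ((isOpen_compl_ofReal_image_Ici 1).mem_nhds hm)
  let F' : ℂ → ℝ → ℂ := fun m θ => (1 - m * (Real.sin θ : ℂ) ^ 2) ^ (-(1 / 2) - 1 : ℂ) *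
    (-(-(1 / 2)) * (Real.sin θ : ℂ) ^ 2)
  have hF' : ContinuousOn (fun x : ℂ × ℝ => F' x.1 x.2)
      ((Complex.ofReal '' Ici (1 : ℝ))ᶜ ×ˢ univ) :=
    (continuousOn_one_sub_mul_sin_sq_cpow _).mul (by fun_prop)
  obtain ⟨C, hC⟩ := ((isCompact_closedBall m r).prod
    (isCompact_Icc (a := (0 : ℝ)) (b := Real.pi / 2))).exists_bound_of_continuousOn
    (hF'.mono (prod_mono hball (subset_univ _)))
  have hIcc : uIoc (0 : ℝ) (Real.pi / 2) ⊆ Icc 0 (Real.pi / 2) := by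
    rw [uIoc_of_le (by positivity)]
    exact Ioc_subset_Icc_self
  refine (intervalIntegral.hasDerivAt_integral_of_dominated_loc_of_deriv_le (F' := F')
    (bound := fun _ => C) (Metric.closedBall_mem_nhds m hr) ?_ ?_ ?_ ?_ ?_ ?_).2.differentiableAt
  · filter_upwards [Metric.closedBall_mem_nhds m hr] with x hx
    exact (continuous_one_sub_mul_sin_sq_cpow _ (hball hx)).aestronglyMeasurable
  · exact (continuous_one_sub_mul_sin_sq_cpow _ hm).intervalIntegrable _ _
  · exact ((continuous_one_sub_mul_sin_sq_cpow _ hm).mul (by fun_prop)).aestronglyMeasurable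
  · exact Eventually.of_forall fun θ hθ x hx => hC (x, θ) ⟨hx, hIcc hθ⟩
  · exact intervalIntegrable_const
  · exact Eventually.of_forall fun θ _ x hx =>
      hasDerivAt_one_sub_mul_sin_sq_cpow (hball hx) θ (-(1 / 2))

theorem ellipticK_zero : ellipticK 0 = Real.pi / 2 := by
  simp [ellipticK]

end EllipticIntegral

section Landen

theorem one_sub_mul_sin_sq_pos {m : ℝ} (hm : m < 1) (x : ℝ) : 0 < 1 - m * Real.sin x ^ 2 := by
  rcases le_total m 0 with hm₀ | hm₀
  · linarith [mul_nonpos_of_nonpos_of_nonneg hm₀ (sq_nonneg (Real.sin x))]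
  · linarith [mul_le_of_le_one_right hm₀ (Real.sin_sq_le_one x)]

theorem continuous_inv_sqrt_one_sub_mul_sin_sq {m : ℝ} (hm : m < 1) :
    Continuous fun x : ℝ => (√(1 - m * Real.sin x ^ 2))⁻¹ :=
  Continuous.inv₀ (by fun_prop) fun x => (Real.sqrt_pos.2 (one_sub_mul_sin_sq_pos hm x)).ne'

theorem ellipticK_ofReal {m : ℝ} (hm : m < 1) : ellipticK m =
    ((∫ θ in (0 : ℝ)..(Real.pi / 2), (√(1 - m * Real.sin θ ^ 2))⁻¹ : ℝ) : ℂ) := by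
  rw [ellipticK, ← intervalIntegral.integral_ofReal]
  refine intervalIntegral.integral_congr fun θ _ => ?_
  have hpos := (one_sub_mul_sin_sq_pos hm θ).le
  have hexp : (-(1 / 2) : ℂ) = ((-(1 / 2) : ℝ) : ℂ) := by push_cast; rfl
  rw [hexp, ← Complex.ofReal_pow, ← Complex.ofReal_mul, ← Complex.ofReal_one,
    ← Complex.ofReal_sub, ← Complex.ofReal_cpow hpos, Real.rpow_neg hpos, ← Real.sqrt_eq_rpow]

/-- The sine of the angle `φ` which Landen's substitution assigns to the angle `x`. -/
def landenSin (k x : ℝ) : ℝ := (1 + k) * Real.sin x / (1 + k * Real.sin x ^ 2)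

variable {k : ℝ}

theorem one_add_mul_sin_sq_pos (hk : |k| < 1) (x : ℝ) : 0 < 1 + k * Real.sin x ^ 2 := by
  simpa using one_sub_mul_sin_sq_pos (neg_lt.1 (abs_lt.1 hk).1) x

theorem four_mul_div_one_add_sq_lt_one (hk : |k| < 1) : 4 * k / (1 + k) ^ 2 < 1 := by
  obtain ⟨hneg, hlt⟩ := abs_lt.1 hk
  rw [div_lt_one (pow_pos (neg_lt_iff_pos_add'.1 hneg) 2)]
  linear_combination pow_pos (sub_pos.2 hlt) 2

theorem continuous_landenSin (hk : |k| < 1) : Continuous (landenSin k) :=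
  Continuous.div (by fun_prop) (by fun_prop) fun x => (one_add_mul_sin_sq_pos hk x).ne'

theorem one_sub_landenSin_sq (hk : |k| < 1) (x : ℝ) : 1 - landenSin k x ^ 2 =
    (Real.cos x * √(1 - k ^ 2 * Real.sin x ^ 2) / (1 + k * Real.sin x ^ 2)) ^ 2 := by
  have hden := (one_add_mul_sin_sq_pos hk x).ne'
  have hnum := one_sub_mul_sin_sq_pos ((sq_lt_one_iff_abs_lt_one k).2 hk) x
  rw [landenSin, div_pow, div_pow, mul_pow, mul_pow, Real.sq_sqrt hnum.le, Real.cos_sq']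
  field_simp
  ring

theorem sin_arcsin_landenSin (hk : |k| < 1) (x : ℝ) :
    Real.sin (Real.arcsin (landenSin k x)) = landenSin k x := by
  have hsq : landenSin k x ^ 2 ≤ 1 := sub_nonneg.1 (one_sub_landenSin_sq hk x ▸ sq_nonneg _)
  have habs := abs_le.1 ((sq_le_one_iff_abs_le_one _).1 hsq)
  exact Real.sin_arcsin habs.1 habs.2

theorem sqrt_one_sub_mul_landenSin_sq (hk : |k| < 1) (x : ℝ) :
    √(1 - 4 * k / (1 + k) ^ 2 * landenSin k x ^ 2) =
      (1 - k * Real.sin x ^ 2) / (1 + k * Real.sin x ^ 2) := by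
  have hk₁ : 1 + k ≠ 0 := (neg_lt_iff_pos_add'.1 (abs_lt.1 hk).1).ne'
  have hden := one_add_mul_sin_sq_pos hk x
  have hsq : 1 - 4 * k / (1 + k) ^ 2 * landenSin k x ^ 2 =
      ((1 - k * Real.sin x ^ 2) / (1 + k * Real.sin x ^ 2)) ^ 2 := by
    have := hden.ne'
    rw [landenSin]
    field_simp
    ring
  rw [hsq, Real.sqrt_sq (div_nonneg (one_sub_mul_sin_sq_pos (abs_lt.1 hk).2 x).le hden.le)]

theorem hasDerivAt_landenSin (hk : |k| < 1) (x : ℝ) : HasDerivAt (landenSin k)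
    ((1 + k) * Real.cos x * (1 - k * Real.sin x ^ 2) / (1 + k * Real.sin x ^ 2) ^ 2) x := by
  have hsin := Real.hasDerivAt_sin x
  refine ((hsin.const_mul (1 + k)).div (((hsin.pow 2).const_mul k).const_add 1)
    (one_add_mul_sin_sq_pos hk x).ne').congr_deriv ?_
  simp only [Pi.pow_apply]
  congr 1
  push_cast
  ring

theorem hasDerivAt_arcsin_landenSin (hk : |k| < 1) {x : ℝ} (hx : 0 < Real.cos x) :
    HasDerivAt (fun x => Real.arcsin (landenSin k x))
      ((1 + k) * ((1 - k * Real.sin x ^ 2) / (1 + k * Real.sin x ^ 2)) *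
        (√(1 - k ^ 2 * Real.sin x ^ 2))⁻¹) x := by
  have hden := one_add_mul_sin_sq_pos hk x
  have hsqrt := Real.sqrt_pos.2
    (one_sub_mul_sin_sq_pos ((sq_lt_one_iff_abs_lt_one k).2 hk) x)
  have hcos : 0 < Real.cos x * √(1 - k ^ 2 * Real.sin x ^ 2) / (1 + k * Real.sin x ^ 2) :=
    div_pos (mul_pos hx hsqrt) hden
  have hlt : 0 < 1 - landenSin k x ^ 2 := one_sub_landenSin_sq hk x ▸ pow_pos hcos 2
  have hneg : landenSin k x ≠ -1 := fun h => by norm_num [h] at hlt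
  have hone : landenSin k x ≠ 1 := fun h => by norm_num [h] at hlt
  refine ((Real.hasDerivAt_arcsin hneg hone).comp x (hasDerivAt_landenSin hk x)).congr_deriv ?_
  rw [one_sub_landenSin_sq hk, Real.sqrt_sq hcos.le]
  have := hden.ne'
  have := hsqrt.ne'
  have := hx.ne'
  field_simp

theorem integral_inv_sqrt_landen (hk : |k| < 1) :
    ∫ θ in (0 : ℝ)..(Real.pi / 2), (√(1 - 4 * k / (1 + k) ^ 2 * Real.sin θ ^ 2))⁻¹ =
      (1 + k) * ∫ θ in (0 : ℝ)..(Real.pi / 2), (√(1 - k ^ 2 * Real.sin θ ^ 2))⁻¹ := by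
  have hcos : ∀ x ∈ Ioo (min 0 (Real.pi / 2)) (max 0 (Real.pi / 2)), 0 < Real.cos x := by
    intro x hx
    rw [min_eq_left (by positivity), max_eq_right (by positivity)] at hx
    exact Real.cos_pos_of_mem_Ioo ⟨by linarith [hx.1, Real.pi_pos], hx.2⟩
  have hcont : Continuous fun x => (1 + k) *
      ((1 - k * Real.sin x ^ 2) / (1 + k * Real.sin x ^ 2)) *
        (√(1 - k ^ 2 * Real.sin x ^ 2))⁻¹ :=
    (continuous_const.mul (Continuous.div (by fun_prop) (by fun_prop) fun x =>
      (one_add_mul_sin_sq_pos hk x).ne')).mul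
      (continuous_inv_sqrt_one_sub_mul_sin_sq ((sq_lt_one_iff_abs_lt_one k).2 hk))
  have hsubst := intervalIntegral.integral_comp_mul_deriv''
    (Real.continuous_arcsin.comp (continuous_landenSin hk)).continuousOn
    (fun x hx => (hasDerivAt_arcsin_landenSin hk (hcos x hx)).hasDerivWithinAt) hcont.continuousOn
    (continuous_inv_sqrt_one_sub_mul_sin_sq (four_mul_div_one_add_sq_lt_one hk)).continuousOn
  have hstart : landenSin k 0 = 0 := by simp [landenSin]
  have hend : landenSin k (Real.pi / 2) = 1 := by
    simp [landenSin, (neg_lt_iff_pos_add'.1 (abs_lt.1 hk).1).ne']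
  simp only [Function.comp_apply, hstart, hend, Real.arcsin_zero, Real.arcsin_one] at hsubst
  rw [← hsubst, ← intervalIntegral.integral_const_mul]
  refine intervalIntegral.integral_congr fun x _ => ?_
  have hnum := (one_sub_mul_sin_sq_pos (abs_lt.1 hk).2 x).ne'
  have hden := (one_add_mul_sin_sq_pos hk x).ne'
  simp only [sin_arcsin_landenSin hk, sqrt_one_sub_mul_landenSin_sq hk]
  field_simp

theorem ellipticK_landen (hk : |k| < 1) :
    ellipticK ((4 * k / (1 + k) ^ 2 : ℝ) : ℂ) = (1 + k) * ellipticK ((k ^ 2 : ℝ) : ℂ) := by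
  rw [ellipticK_ofReal (four_mul_div_one_add_sq_lt_one hk),
    ellipticK_ofReal ((sq_lt_one_iff_abs_lt_one k).2 hk), integral_inv_sqrt_landen hk]
  push_cast
  rfl

end Landen

/-! ### The elliptic integral as a theta constant -/

section EllipticIntegralOfNome

variable {x : ℝ}

theorem lacunarySeries_ofReal (e : ℤ → ℕ) (x : ℝ) :
    lacunarySeries e x = ((∑' n : ℤ, x ^ e n : ℝ) : ℂ) := by
  rw [lacunarySeries, Complex.ofReal_tsum]
  simp only [Complex.ofReal_pow]

theorem norm_ofReal_lt_one (hx : |x| < 1) : ‖(x : ℂ)‖ < 1 := by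
  rwa [Complex.norm_real, Real.norm_eq_abs]

theorem exists_modulus_eq_ofReal (hx : |x| < 1) : ∃ k : ℝ, |k| < 1 ∧ modulus x = k := by
  have hx₂ := norm_sq_lt_one (norm_ofReal_lt_one hx)
  have hcompl := one_sub_inverseNome hx₂
  have hthree := thetaThree_ne_zero hx₂
  have hthree_neg := thetaThree_ne_zero (z := -(x : ℂ) ^ 2) (by rwa [norm_neg])
  have hmod : modulus x = ((x * (∑' n : ℤ, (x ^ 2) ^ pronicExp n) ^ 2 /
      (∑' n : ℤ, (x ^ 2) ^ squareExp n) ^ 2 : ℝ) : ℂ) := by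
    rw [modulus, thetaTwo, thetaThree, ← Complex.ofReal_pow, lacunarySeries_ofReal,
      lacunarySeries_ofReal]
    push_cast
    rfl
  refine ⟨_, ?_, hmod⟩
  rw [← modulus_sq, hmod] at hcompl
  rw [thetaThree, ← Complex.ofReal_pow, lacunarySeries_ofReal, Complex.ofReal_ne_zero] at hthree
  rw [thetaThree, ← Complex.ofReal_pow, ← Complex.ofReal_neg, lacunarySeries_ofReal,
    Complex.ofReal_ne_zero] at hthree_neg
  rw [thetaThree, thetaThree, ← Complex.ofReal_pow x, ← Complex.ofReal_neg, lacunarySeries_ofReal,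
    lacunarySeries_ofReal] at hcompl
  norm_cast at hcompl
  rw [← sq_lt_one_iff_abs_lt_one, ← sub_pos, hcompl]
  positivity

theorem norm_inverseNome_sq_ofReal_lt_one (hx : |x| < 1) : ‖inverseNome ((x : ℂ) ^ 2)‖ < 1 := by
  obtain ⟨k, hk, hmod⟩ := exists_modulus_eq_ofReal hx
  rw [← modulus_sq, hmod]
  exact norm_sq_lt_one (norm_ofReal_lt_one hk)

theorem inverseNome_ofReal_notMem_Ici (hx : |x| < 1) :
    inverseNome x ∉ Complex.ofReal '' Ici (1 : ℝ) := by
  obtain ⟨k, hk, hmod⟩ := exists_modulus_eq_ofReal hx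
  rw [inverseNome_eq_modulus (norm_ofReal_lt_one hx), hmod]
  rintro ⟨y, hy, h⟩
  norm_cast at h
  exact (four_mul_div_one_add_sq_lt_one hk).not_ge (h ▸ hy)

theorem ellipticK_inverseNome_mul_sq (hx : |x| < 1) :
    ellipticK (inverseNome x) * thetaThree ((x : ℂ) ^ 2) ^ 2 =
      ellipticK (inverseNome ((x : ℂ) ^ 2)) * thetaThree x ^ 2 := by
  have hx' := norm_ofReal_lt_one hx
  obtain ⟨k, hk, hmod⟩ := exists_modulus_eq_ofReal hx
  have hlanden := ellipticK_landen hk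
  push_cast at hlanden
  rw [inverseNome_eq_modulus hx', ← modulus_sq, thetaThree_sq_eq_modulus hx', hmod, hlanden]
  ring

theorem ellipticK_inverseNome_mul_pow_two_pow (hx : |x| < 1) (n : ℕ) :
    ellipticK (inverseNome x) * thetaThree ((x : ℂ) ^ 2 ^ n) ^ 2 =
      ellipticK (inverseNome ((x : ℂ) ^ 2 ^ n)) * thetaThree x ^ 2 := by
  induction n with
  | zero => simp
  | succ n ih =>
    have hxn : |x ^ 2 ^ n| < 1 := by
      rw [abs_pow]
      exact pow_lt_one₀ (abs_nonneg x) hx (by positivity)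
    have hsq := ellipticK_inverseNome_mul_sq hxn
    have hthree := thetaThree_ne_zero (norm_ofReal_lt_one hxn)
    rw [Complex.ofReal_pow] at hsq hthree
    rw [← pow_mul, ← pow_succ] at hsq
    refine mul_right_cancel₀ (pow_ne_zero 2 hthree) ?_
    linear_combination
      thetaThree ((x : ℂ) ^ 2 ^ (n + 1)) ^ 2 * ih + thetaThree (x : ℂ) ^ 2 * hsq

theorem ellipticK_inverseNome_ofReal (hx : |x| < 1) :
    ellipticK (inverseNome x) = Real.pi / 2 * thetaThree x ^ 2 := by
  have hlim : Tendsto (fun n : ℕ => (x : ℂ) ^ 2 ^ n) atTop (𝓝 0) :=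
    (tendsto_pow_atTop_nhds_zero_of_norm_lt_one (norm_ofReal_lt_one hx)).comp
      (tendsto_pow_atTop_atTop_of_one_lt one_lt_two)
  have hthree : ContinuousAt thetaThree 0 := (differentiableAt_thetaThree (by simp)).continuousAt
  have hK : ContinuousAt (ellipticK ∘ inverseNome) 0 := by
    refine ContinuousAt.comp ?_ (differentiableAt_inverseNome (by simp)).continuousAt
    rw [inverseNome_zero]
    exact (differentiableAt_ellipticK (notMem_of_norm_lt (by simp))).continuousAt
  have hleft := ((hthree.tendsto.comp hlim).pow 2).const_mul (ellipticK (inverseNome x))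
  simp only [Function.comp_apply, ellipticK_inverseNome_mul_pow_two_pow hx] at hleft
  have heq := tendsto_nhds_unique hleft ((hK.tendsto.comp hlim).mul_const (thetaThree x ^ 2))
  rwa [Function.comp_apply, thetaThree_zero, inverseNome_zero, ellipticK_zero, one_pow,
    mul_one] at heq

theorem ellipticK_inverseNome_eventuallyEq (hx : |x| < 1) :
    ellipticK ∘ inverseNome =ᶠ[𝓝 (x : ℂ)] fun z => Real.pi / 2 * thetaThree z ^ 2 := by
  have hx' := norm_ofReal_lt_one hx
  have hball : Metric.ball (0 : ℂ) 1 ∈ 𝓝 (x : ℂ) :=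
    Metric.isOpen_ball.mem_nhds (mem_ball_zero_iff.2 hx')
  have hK : AnalyticAt ℂ (ellipticK ∘ inverseNome) x := by
    refine AnalyticAt.comp ?_ (analyticOnNhd_inverseNome _ (mem_ball_zero_iff.2 hx'))
    exact DifferentiableOn.analyticAt (s := (Complex.ofReal '' Ici (1 : ℝ))ᶜ) (fun m hm =>
      (differentiableAt_ellipticK hm).differentiableWithinAt)
      ((isOpen_compl_ofReal_image_Ici 1).mem_nhds (inverseNome_ofReal_notMem_Ici hx))
  have hthree : AnalyticAt ℂ thetaThree x :=
    DifferentiableOn.analyticAt (fun z hz =>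
      (differentiableAt_thetaThree (mem_ball_zero_iff.1 hz)).differentiableWithinAt) hball
  refine (hK.frequently_eq_iff_eventually_eq (analyticAt_const.mul (hthree.pow 2))).1 ?_
  have hreal : Tendsto Complex.ofReal (𝓝[≠] x) (𝓝[≠] (x : ℂ)) :=
    Complex.continuous_ofReal.continuousWithinAt.tendsto_nhdsWithin fun _ hy =>
      Complex.ofReal_injective.ne hy
  refine hreal.frequently (Eventually.frequently (eventually_nhdsWithin_of_eventually_nhds ?_))
  filter_upwards [continuous_abs.continuousAt.eventually_lt continuousAt_const hx] with y hy
  exact ellipticK_inverseNome_ofReal hy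

end EllipticIntegralOfNome

/-! ### The principal section of the modular function -/

section SlitSection

open scoped UpperHalfPlane Modular

variable {w : ℂ}

/-- The plane slit along `(-∞, 0]` and `[1, ∞)`, on which `ellipticK m` and `ellipticK (1 - m)` are
both analytic. -/
def doublySlitPlane : Set ℂ := Complex.slitPlane ∩ (1 - ·) ⁻¹' Complex.slitPlane

theorem mem_doublySlitPlane (hw₀ : w ∉ Complex.ofReal '' Iic (0 : ℝ))
    (hw₁ : w ∉ Complex.ofReal '' Ici (1 : ℝ)) : w ∈ doublySlitPlane := by
  refine ⟨?_, one_sub_mem_slitPlane_iff.2 hw₁⟩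
  rw [Complex.mem_slitPlane_iff_not_le_zero, Complex.le_def]
  exact fun hw => hw₀ ⟨w.re, hw.1, Complex.ext rfl hw.2.symm⟩

theorem one_sub_mem_doublySlitPlane (hw : w ∈ doublySlitPlane) : 1 - w ∈ doublySlitPlane :=
  ⟨hw.2, by simpa using hw.1⟩

theorem ne_of_mem_doublySlitPlane (hw : w ∈ doublySlitPlane) : w ≠ 0 ∧ w ≠ 1 :=
  ⟨Complex.slitPlane_ne_zero hw.1, (sub_ne_zero.1 (Complex.slitPlane_ne_zero hw.2)).symm⟩

theorem isOpen_doublySlitPlane : IsOpen doublySlitPlane :=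
  Complex.isOpen_slitPlane.inter (Complex.isOpen_slitPlane.preimage (by fun_prop))

theorem half_mem_doublySlitPlane : (1 / 2 : ℂ) ∈ doublySlitPlane := by
  norm_num [doublySlitPlane, Complex.mem_slitPlane_iff]

theorem starConvex_doublySlitPlane : StarConvex ℝ (1 / 2 : ℂ) doublySlitPlane := by
  have hslit : StarConvex ℝ (1 / 2 : ℂ) Complex.slitPlane := by
    simpa using Complex.starConvex_ofReal_slitPlane (x := 1 / 2) (by norm_num)
  refine hslit.inter (StarConvex.affine_preimage (AffineEquiv.constVSub ℝ (1 : ℂ)).toAffineMap ?_)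
  rwa [← sub_half (1 : ℂ)] at hslit

theorem isPreconnected_doublySlitPlane : IsPreconnected doublySlitPlane :=
  (starConvex_doublySlitPlane.isPathConnected half_mem_doublySlitPlane).isConnected.isPreconnected

theorem analyticOnNhd_of_rightInvOn {f s : ℂ → ℂ} {V : Set ℂ} (hV : IsOpen V)
    (hs : ContinuousOn s V) (hfs : RightInvOn s f V) (hf' : ∀ v ∈ V, deriv f (s v) ≠ 0) :
    AnalyticOnNhd ℂ s V := by
  refine DifferentiableOn.analyticOnNhd (fun v hv => ?_) hV
  have hf := (differentiableAt_of_deriv_ne_zero (hf' v hv)).hasDerivAt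
  exact (hf.of_local_left_inverse (hs.continuousAt (hV.mem_nhds hv)) (hf' v hv)
    (eventually_of_mem (hV.mem_nhds hv) hfs)).differentiableAt.differentiableWithinAt

theorem S_smul_I : ModularGroup.S • UpperHalfPlane.I = UpperHalfPlane.I := by
  rw [UpperHalfPlane.modular_S_smul]
  ext1
  simp

theorem modularLambda_I : (modularLambda UpperHalfPlane.I : ℂ) = 1 / 2 := by
  have hsymm := congrArg Subtype.val (modularLambda_S_smul UpperHalfPlane.I)
  rw [S_smul_I, TwicePuncturedPlane.coe_oneSub] at hsymm
  linear_combination hsymm / 2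

theorem exists_slitSection : ∃ s : ℂ → ℍ, ContinuousOn s doublySlitPlane ∧
    (∀ w ∈ doublySlitPlane, (modularLambda (s w) : ℂ) = w) ∧ s (1 / 2) = UpperHalfPlane.I := by
  have : ContractibleSpace doublySlitPlane :=
    starConvex_doublySlitPlane.contractibleSpace ⟨_, half_mem_doublySlitPlane⟩
  have : SimplyConnectedSpace doublySlitPlane := SimplyConnectedSpace.ofContractible _
  have : LocallyPathConnectedSpace doublySlitPlane :=
    isOpen_doublySlitPlane.locallyPathConnectedSpace
  let incl : C(doublySlitPlane, TwicePuncturedPlane) :=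
    ⟨fun w => ⟨w, ne_of_mem_doublySlitPlane w.2⟩, by fun_prop⟩
  obtain ⟨F, ⟨hF_half, hF⟩, -⟩ := isCoveringMap_modularLambda.existsUnique_continuousMap_lifts
    incl ⟨1 / 2, half_mem_doublySlitPlane⟩ UpperHalfPlane.I (Subtype.ext modularLambda_I)
  have hext : ∀ w : doublySlitPlane,
      Function.extend Subtype.val F (fun _ => UpperHalfPlane.I) w = F w :=
    Subtype.val_injective.extend_apply F _
  refine ⟨Function.extend Subtype.val F fun _ => UpperHalfPlane.I, ?_, fun w hw => ?_,
    (hext ⟨1 / 2, half_mem_doublySlitPlane⟩).trans hF_half⟩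
  · rw [continuousOn_iff_continuous_domRestrict]
    exact F.continuous.congr fun w => (hext w).symm
  · rw [hext ⟨w, hw⟩]
    exact congrArg Subtype.val (congrFun hF ⟨w, hw⟩)

/-- The continuous section of the modular function over the doubly slit plane which takes the value
`i` at `1 / 2`. -/
def slitSection : ℂ → ℍ := exists_slitSection.choose

theorem continuousOn_slitSection : ContinuousOn slitSection doublySlitPlane :=
  exists_slitSection.choose_spec.1

theorem modularLambda_slitSection (hw : w ∈ doublySlitPlane) :
    (modularLambda (slitSection w) : ℂ) = w :=
  exists_slitSection.choose_spec.2.1 w hw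

theorem slitSection_half : slitSection (1 / 2) = UpperHalfPlane.I :=
  exists_slitSection.choose_spec.2.2

theorem slitSection_one_sub (hw : w ∈ doublySlitPlane) :
    slitSection (1 - w) = ModularGroup.S • slitSection w := by
  refine (T2Space.isSeparatedMap modularLambda).eqOn_of_comp_eqOn
    isLocalHomeomorph_modularLambda.isLocallyInjective isPreconnected_doublySlitPlane
    (continuousOn_slitSection.comp (by fun_prop) fun _ => one_sub_mem_doublySlitPlane)
    ((continuous_const_smul (ModularGroup.S : GL (Fin 2) ℝ)).comp_continuousOn
      continuousOn_slitSection) (fun w hw => ?_)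
    half_mem_doublySlitPlane ?_ hw
  · refine Subtype.ext ((modularLambda_slitSection (one_sub_mem_doublySlitPlane hw)).trans ?_)
    refine .trans ?_ (congrArg Subtype.val (modularLambda_S_smul (slitSection w))).symm
    rw [TwicePuncturedPlane.coe_oneSub, modularLambda_slitSection hw]
  · change slitSection (1 - 1 / 2) = ModularGroup.S • slitSection (1 / 2)
    rw [sub_half, slitSection_half, S_smul_I]

theorem analyticOnNhd_slitSection :
    AnalyticOnNhd ℂ (fun w => (slitSection w : ℂ)) doublySlitPlane :=
  analyticOnNhd_of_rightInvOn isOpen_doublySlitPlane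
    (UpperHalfPlane.continuous_coe.comp_continuousOn continuousOn_slitSection)
    (f := inverseNome ∘ nome) (fun _ hw => modularLambda_slitSection hw)
    fun w _ => deriv_inverseNome_nome_ne_zero (slitSection w).2

theorem analyticAt_thetaThree_nome {τ : ℂ} (hτ : 0 < τ.im) :
    AnalyticAt ℂ (fun τ => thetaThree (nome τ)) τ :=
  DifferentiableOn.analyticAt (s := {τ | 0 < τ.im}) (fun σ hσ =>
    ((differentiableAt_thetaThree (norm_nome_lt_one hσ)).comp σ
      (hasDerivAt_nome σ).differentiableAt).differentiableWithinAt)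
    (UpperHalfPlane.isOpen_upperHalfPlaneSet.mem_nhds hτ)

theorem ellipticK_eq_thetaThree (hw : w ∈ doublySlitPlane) :
    ellipticK w = Real.pi / 2 * thetaThree (nome (slitSection w)) ^ 2 := by
  have hK : AnalyticOnNhd ℂ ellipticK doublySlitPlane :=
    DifferentiableOn.analyticOnNhd (fun w hw => (differentiableAt_ellipticK
      (one_sub_mem_slitPlane_iff.1 hw.2)).differentiableWithinAt) isOpen_doublySlitPlane
  have htheta : AnalyticOnNhd ℂ
      (fun w => Real.pi / 2 * thetaThree (nome (slitSection w)) ^ 2) doublySlitPlane := fun w hw =>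
    analyticAt_const.mul ((AnalyticAt.comp (f := fun w => (slitSection w : ℂ))
      (analyticAt_thetaThree_nome (slitSection w).2) (analyticOnNhd_slitSection w hw)).pow 2)
  refine hK.eqOn_of_preconnected_of_eventuallyEq htheta isPreconnected_doublySlitPlane
    half_mem_doublySlitPlane ?_ hw
  have hslit : doublySlitPlane ∈ 𝓝 (1 / 2) :=
    isOpen_doublySlitPlane.mem_nhds half_mem_doublySlitPlane
  have hcont : ContinuousAt (fun w => nome (slitSection w)) (1 / 2) :=
    (hasDerivAt_nome _).continuousAt.comp
      (analyticOnNhd_slitSection _ half_mem_doublySlitPlane).continuousAt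
  have hI : nome (slitSection (1 / 2)) = (Real.exp (-Real.pi) : ℝ) := by
    rw [slitSection_half, UpperHalfPlane.coe_I, nome_I]
  have hlt : |Real.exp (-Real.pi)| < 1 := by
    rw [Real.abs_exp, Real.exp_lt_one_iff, neg_lt_zero]
    exact Real.pi_pos
  filter_upwards [hcont.eventually (hI ▸ ellipticK_inverseNome_eventuallyEq hlt), hslit]
    with v hv hv_mem
  rw [← hv, Function.comp_apply]
  exact congrArg ellipticK (modularLambda_slitSection hv_mem).symm

theorem ellipticK_one_sub_eq_thetaThree (hw : w ∈ doublySlitPlane) : ellipticK (1 - w) =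
    Real.pi / 2 * (-Complex.I * slitSection w * thetaThree (nome (slitSection w)) ^ 2) := by
  rw [ellipticK_eq_thetaThree (one_sub_mem_doublySlitPlane hw), slitSection_one_sub hw,
    ← thetaThree_nome_neg_inv_sq, UpperHalfPlane.modular_S_smul, UpperHalfPlane.coe_mk, inv_neg,
    neg_div, one_div]

theorem exp_neg_pi_mul_div_eq_nome (τ : ℍ) : Complex.exp (-(Real.pi : ℂ) *
    ((Real.pi / 2 * (-Complex.I * τ * thetaThree (nome τ) ^ 2)) /
      (Real.pi / 2 * thetaThree (nome τ) ^ 2))) = nome τ := by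
  have hthree := thetaThree_ne_zero (norm_nome_lt_one τ.2)
  have hpi : (Real.pi : ℂ) ≠ 0 := by simp
  conv_rhs => rw [nome]
  congr 1
  field_simp

end SlitSection

/-! ### The inverse nome as a branched covering of the plane -/

section DiscMap

open scoped UpperHalfPlane

instance : Zero disc := ⟨⟨0, Metric.mem_ball_self one_pos⟩⟩

theorem disc.coe_zero : ((0 : disc) : ℂ) = 0 := rfl

theorem disc.norm_lt (z : disc) : ‖(z : ℂ)‖ < 1 := mem_ball_zero_iff.1 z.2

theorem disc.coe_ne_zero_iff {z : disc} : (z : ℂ) ≠ 0 ↔ z ≠ 0 :=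
  Subtype.coe_injective.ne_iff' disc.coe_zero

/-- The inverse nome as a map on the type `disc`; it is the projection of the surface read through
the uniformization. -/
def inverseNomeDisc (z : disc) : ℂ := inverseNome z

theorem isLocalHomeomorph_inverseNomeDisc : IsLocalHomeomorph inverseNomeDisc :=
  isLocalHomeomorph_comp_of_hasStrictDerivAt disc.isOpen.isOpenEmbedding_subtypeVal
    (fun z => (analyticOnNhd_inverseNome z z.2).hasStrictDerivAt)
    fun z => deriv_inverseNome_ne_zero (disc.norm_lt z)

theorem continuous_inverseNomeDisc : Continuous inverseNomeDisc :=
  isLocalHomeomorph_inverseNomeDisc.continuous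

theorem eqOn_of_inverseNomeDisc_eq {A : Type*} [TopologicalSpace A] {s : Set A}
    (hs : IsPreconnected s) {f g : A → disc} (hf : ContinuousOn f s) (hg : ContinuousOn g s)
    (h : ∀ a ∈ s, inverseNomeDisc (f a) = inverseNomeDisc (g a)) {a : A} (ha : a ∈ s)
    (hfg : f a = g a) : EqOn f g s :=
  (T2Space.isSeparatedMap inverseNomeDisc).eqOn_of_comp_eqOn
    isLocalHomeomorph_inverseNomeDisc.isLocallyInjective hs hf hg h ha hfg

theorem inverseNomeDisc_zero : inverseNomeDisc 0 = 0 := inverseNome_zero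

theorem inverseNomeDisc_eq_zero_iff {z : disc} : inverseNomeDisc z = 0 ↔ z = 0 := by
  refine ⟨not_imp_not.1 fun hz => ?_, fun hz => hz ▸ inverseNomeDisc_zero⟩
  exact inverseNome_ne_zero (disc.norm_lt z) (disc.coe_ne_zero_iff.2 hz)

/-- The nome of a point of the upper half-plane, as a point of the type `disc`. -/
def nomeDisc (τ : ℍ) : disc := ⟨nome τ, mem_ball_zero_iff.2 (norm_nome_lt_one τ.2)⟩

theorem continuous_nomeDisc : Continuous nomeDisc := by
  refine Continuous.subtype_mk (f := fun τ : ℍ => nome τ) ?_ _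
  exact (continuous_iff_continuousAt.2 fun τ => (hasDerivAt_nome τ).continuousAt).comp
    UpperHalfPlane.continuous_coe

theorem inverseNomeDisc_nomeDisc (τ : ℍ) : inverseNomeDisc (nomeDisc τ) = modularLambda τ := rfl

theorem exists_nomeDisc_eq {z : disc} (hz : z ≠ 0) : ∃ τ : ℍ, nomeDisc τ = z := by
  have hz₀ := disc.coe_ne_zero_iff.2 hz
  have him : (Complex.log z / (Real.pi * Complex.I)).im = -Real.log ‖(z : ℂ)‖ / Real.pi := by
    rw [← Complex.log_re, ← div_div, Complex.div_I, ← neg_mul, Complex.mul_I_im, Complex.neg_re,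
      Complex.div_ofReal_re, neg_div]
  have him_pos : 0 < (Complex.log z / (Real.pi * Complex.I)).im := by
    rw [him]
    exact div_pos (neg_pos.2 (Real.log_neg (norm_pos_iff.2 hz₀) (disc.norm_lt z))) Real.pi_pos
  refine ⟨⟨_, him_pos⟩, Subtype.ext ?_⟩
  change nome (Complex.log z / (Real.pi * Complex.I)) = z
  rw [nome, mul_div_cancel₀ _ (mul_ne_zero (by simp) Complex.I_ne_zero), Complex.exp_log hz₀]

end DiscMap

/-! ### Lifting admissible curves to the disc -/

section Lifting

open scoped UpperHalfPlane unitInterval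

theorem exists_lift_modularLambda {f : C(I, ℂ)} {t₁ : I}
    (hf : ∀ t, t₁ ≤ t → f t ≠ 0 ∧ f t ≠ 1) {τ₁ : ℍ} (hτ₁ : modularLambda τ₁ = f t₁) :
    ∃ T : C(I, ℍ), T t₁ = τ₁ ∧ ∀ t, t₁ ≤ t → modularLambda (T t) = f t := by
  let r : C(ℝ, I) := ⟨fun x => max t₁ (projIcc 0 1 zero_le_one x), by fun_prop⟩
  have hr : ∀ t : I, t₁ ≤ t → r t = t := fun t ht => by simp [r, projIcc_val, ht]
  obtain ⟨T, ⟨hT₁, hT⟩, -⟩ := isCoveringMap_modularLambda.existsUnique_continuousMap_lifts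
    ⟨fun x => ⟨f (r x), hf _ (le_max_left _ _)⟩, Continuous.subtype_mk (by fun_prop) _⟩
    (a₀ := (t₁ : ℝ)) (e₀ := τ₁) (Subtype.ext (by simpa [hr] using hτ₁))
  refine ⟨⟨fun t => T t, by fun_prop⟩, hT₁, fun t ht => ?_⟩
  conv_rhs => rw [← hr t ht]
  exact congrArg Subtype.val (congrFun hT (t : ℝ))

theorem exists_initial_lift {f : C(I, ℂ)} (hf : f 0 = 0) : ∃ ε : I, 0 < ε ∧
    ∃ Γ : C(I, disc), Γ 0 = 0 ∧ ∀ t, t ≤ ε → inverseNomeDisc (Γ t) = f t := by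
  obtain ⟨e, he₀, he⟩ := isLocalHomeomorph_inverseNomeDisc 0
  have he_zero : e 0 = 0 := by rw [← he, inverseNomeDisc_zero]
  have htarget : ∀ᶠ t in 𝓝 (0 : I), f t ∈ e.target :=
    f.continuous.continuousAt.eventually
      (e.open_target.mem_nhds (by rw [hf, ← he_zero]; exact e.map_source he₀))
  obtain ⟨u, hu, hu_target⟩ := exists_Ico_subset_of_mem_nhds htarget ⟨1, zero_lt_one⟩
  obtain ⟨ε, hε, hεu⟩ := exists_between hu
  have hmem : ∀ t, t ≤ ε → f t ∈ e.target := fun t ht => hu_target ⟨t.2.1, ht.trans_lt hεu⟩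
  refine ⟨ε, hε, ⟨fun t => e.symm (f (min t ε)), ?_⟩, ?_, fun t ht => ?_⟩
  · exact e.continuousOn_symm.comp_continuous (by fun_prop) fun t => hmem _ (min_le_right _ _)
  · simp only [ContinuousMap.coe_mk, min_eq_left hε.le, hf]
    rw [← he_zero, e.left_inv he₀]
  · simp only [ContinuousMap.coe_mk, min_eq_left ht]
    rw [he, e.right_inv (hmem t ht)]

theorem exists_lift (γ : Curve) :
    ∃ Γ : C(I, disc), Γ 0 = 0 ∧ ∀ t, inverseNomeDisc (Γ t) = γ.1 t := by
  rcases eq_or_ne (γ.1 1) 0 with hγ | hγ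
  · have hconst : ∀ t, γ.1 t = 0 := γ.2.2.resolve_right fun h => (h 1 one_ne_zero).1 hγ
    exact ⟨.const _ 0, rfl, fun t => (hconst t).symm ▸ inverseNomeDisc_zero⟩
  obtain ⟨ε, hε, Γ₀, hΓ₀_zero, hΓ₀⟩ := exists_initial_lift γ.2.1
  have hΓ₀ε : Γ₀ ε ≠ 0 := by
    rw [Ne, ← inverseNomeDisc_eq_zero_iff, hΓ₀ ε le_rfl]
    exact (γ.ne_of_end hγ ε hε.ne').1
  obtain ⟨τ, hτ⟩ := exists_nomeDisc_eq hΓ₀ε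
  obtain ⟨T, hTε, hT⟩ := exists_lift_modularLambda (f := γ.1) (t₁ := ε) (τ₁ := τ)
    (fun t ht => γ.ne_of_end hγ t (hε.trans_le ht).ne')
    (by rw [← inverseNomeDisc_nomeDisc, hτ, hΓ₀ ε le_rfl])
  refine ⟨⟨fun t => if t ≤ ε then Γ₀ t else nomeDisc (T t), ?_⟩, ?_, fun t => ?_⟩
  · refine Continuous.if_le (by fun_prop) (continuous_nomeDisc.comp T.continuous) continuous_id
      continuous_const fun t ht => ?_
    rw [ht, hTε, hτ]
  · simp [hΓ₀_zero]
  · simp only [ContinuousMap.coe_mk]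
    split_ifs with ht
    · exact hΓ₀ t ht
    · rw [inverseNomeDisc_nomeDisc, hT t (not_le.1 ht).le]

theorem lift_unique {Γ Γ' : C(I, disc)} (h₀ : Γ 0 = Γ' 0)
    (h : ∀ t, inverseNomeDisc (Γ t) = inverseNomeDisc (Γ' t)) : Γ = Γ' :=
  ContinuousMap.ext fun t => eqOn_of_inverseNomeDisc_eq isPreconnected_univ
    Γ.continuous.continuousOn Γ'.continuous.continuousOn (fun t _ => h t) (mem_univ 0) h₀
    (mem_univ t)

theorem lift_end_eq {γ γ' : Curve} (h : γ ≈ γ') {Γ Γ' : C(I, disc)} (hΓ₀ : Γ 0 = 0)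
    (hΓ₀' : Γ' 0 = 0) (hΓ : ∀ t, inverseNomeDisc (Γ t) = γ.1 t)
    (hΓ' : ∀ t, inverseNomeDisc (Γ' t) = γ'.1 t) : Γ 1 = Γ' 1 := by
  obtain ⟨H⟩ := h
  have hcurve : ∀ s, IsCurve (H.toHomotopy.curry s) := fun s => (H.prop s).1
  have hend : ∀ s, H.toHomotopy.curry s 1 = γ.1 1 := fun s => (H.prop s).2
  choose L hL₀ hL using fun s => exists_lift ⟨_, hcurve s⟩
  let R : ContinuousMap.HomotopyRel γ.1 γ'.1 {0, 1} := ⟨H.toHomotopy, fun s t ht => by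
    rcases ht with rfl | rfl
    · exact (hcurve s).1.trans γ.2.1.symm
    · exact hend s⟩
  have hmonodromy := isLocalHomeomorph_inverseNomeDisc.monodromy_theorem
    (T2Space.isSeparatedMap inverseNomeDisc) R L (fun s t => hL s t)
    (fun s => by rw [hL₀, hL₀]) 1
  have hL_zero : L 0 = Γ := lift_unique (by rw [hL₀, hΓ₀]) fun t => by
    rw [hL, hΓ]
    exact H.apply_zero t
  have hL_one : L 1 = Γ' := lift_unique (by rw [hL₀, hΓ₀']) fun t => by
    rw [hL, hΓ']
    exact H.apply_one t
  rw [← hL_zero, ← hL_one, hmonodromy]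

end Lifting

/-! ### The uniformization of the surface -/

section Uniformization

open scoped unitInterval

theorem norm_segMap_lt_one {w : ℂ} (hw : ‖w‖ < 1) (t : I) : ‖segMap w t‖ < 1 := by
  have hnorm : ‖segMap w t‖ = t * ‖w‖ := by simp [segMap, abs_of_nonneg t.2.1]
  rw [hnorm]
  exact (mul_le_of_le_one_left (norm_nonneg w) t.2.2).trans_lt hw

theorem segMap_zero (w : ℂ) : segMap w 0 = 0 := by simp [segMap]

theorem segMap_one (w : ℂ) : segMap w 1 = w := by simp [segMap]

theorem segMap_ne_zero {w : ℂ} (hw : w ≠ 0) {t : I} (ht : t ≠ 0) : segMap w t ≠ 0 :=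
  mul_ne_zero (Complex.ofReal_ne_zero.2 (Set.Icc.coe_ne_zero.2 ht)) hw

/-- The segment from `0` to a point of the disc, as a path in the type `disc`. -/
def ray (z : disc) : C(I, disc) :=
  ⟨fun t => ⟨segMap z t, mem_ball_zero_iff.2 (norm_segMap_lt_one (disc.norm_lt z) t)⟩,
    Continuous.subtype_mk (segMap z).continuous _⟩

theorem ray_zero (z : disc) : ray z 0 = 0 := Subtype.ext (segMap_zero z)

theorem ray_one (z : disc) : ray z 1 = z := Subtype.ext (segMap_one z)

theorem ray_eq_zero_or_ne_zero (z : disc) : (∀ t, ray z t = 0) ∨ ∀ t, t ≠ 0 → ray z t ≠ 0 := by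
  rcases eq_or_ne z 0 with rfl | hz
  · exact Or.inl fun t => Subtype.ext (mul_zero _)
  · exact Or.inr fun t ht => disc.coe_ne_zero_iff.1 (segMap_ne_zero (disc.coe_ne_zero_iff.2 hz) ht)

theorem norm_mul_exp_le_max (a d : ℂ) (s : I) :
    ‖a * Complex.exp ((s : ℝ) * d)‖ ≤ max ‖a‖ ‖a * Complex.exp d‖ := by
  simp only [norm_mul, Complex.norm_exp, Complex.re_ofReal_mul]
  rcases le_total 0 d.re with hd | hd
  · refine le_max_of_le_right ?_
    gcongr
    exact mul_le_of_le_one_left hd s.2.2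
  · refine le_max_of_le_left (mul_le_of_le_one_right (norm_nonneg a) ?_)
    exact Real.exp_le_one_iff.2 (mul_nonpos_of_nonneg_of_nonpos s.2.1 hd)

theorem continuous_mul_exp_of_eq_zero {X : Type*} [TopologicalSpace X] [T1Space X] {x₀ : X}
    {a b D : X → ℂ} (ha : Continuous a) (hb : Continuous b) (ha₀ : a x₀ = 0) (hb₀ : b x₀ = 0)
    (hD : ContinuousOn D {x₀}ᶜ) (hab : ∀ x, x ≠ x₀ → b x = a x * Complex.exp (D x)) :
    Continuous fun y : I × X => a y.2 * Complex.exp ((y.1 : ℝ) * D y.2) := by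
  refine continuous_iff_continuousAt.2 fun ⟨s, x⟩ => ?_
  rcases eq_or_ne x x₀ with rfl | hx
  · have hbound : ∀ y : I × X,
        ‖a y.2 * Complex.exp ((y.1 : ℝ) * D y.2)‖ ≤ max ‖a y.2‖ ‖b y.2‖ := by
      intro y
      rcases eq_or_ne y.2 x with hy | hy
      · simp [hy, ha₀]
      · exact hab y.2 hy ▸ norm_mul_exp_le_max _ _ _
    have hmax : Continuous fun y : I × X => max ‖a y.2‖ ‖b y.2‖ := by fun_prop
    rw [ContinuousAt, ha₀, zero_mul]
    exact squeeze_zero_norm hbound (by simpa [ha₀, hb₀] using hmax.tendsto (s, x))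
  · have hDx : ContinuousAt (fun y : I × X => D y.2) (s, x) :=
      ContinuousAt.comp (f := Prod.snd) (x := (s, x))
        (hD.continuousAt (isOpen_compl_singleton.mem_nhds hx)) continuousAt_snd
    have hs : ContinuousAt (fun y : I × X => ((y.1 : ℝ) : ℂ)) (s, x) :=
      Continuous.continuousAt (by fun_prop)
    exact (ha.continuousAt.comp continuousAt_snd).mul (hs.mul hDx).cexp

/- The logarithm of `Γ t / (t * Γ 1)` is continuous for `t ≠ 0`; scaling it by `s ∈ [0, 1]`
interpolates between the ray and `Γ` without leaving the disc. -/
theorem exists_homotopyRel_ray {Γ : C(I, disc)} (hΓ₀ : Γ 0 = 0) (hΓ : ∀ t, t ≠ 0 → Γ t ≠ 0) :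
    ∃ F : (ray (Γ 1)).HomotopyRel Γ {0, 1}, ∀ s t, t ≠ 0 → F (s, t) ≠ 0 := by
  have hΓ_coe : ∀ t, t ≠ 0 → (Γ t : ℂ) ≠ 0 := fun t ht => disc.coe_ne_zero_iff.2 (hΓ t ht)
  have hseg : ∀ t : I, t ≠ 0 → segMap (Γ 1) t ≠ 0 := fun t =>
    segMap_ne_zero (hΓ_coe 1 one_ne_zero)
  obtain ⟨D, hD, hD₁, hexp⟩ := logLift ⟨fun t => (Γ t : ℂ), by fun_prop⟩ (segMap (Γ 1)) hΓ_coe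
    hseg (segMap_one _).symm
  have hcont := continuous_mul_exp_of_eq_zero (segMap (Γ 1)).continuous
    (continuous_subtype_val.comp Γ.continuous) (segMap_zero _) (congrArg Subtype.val hΓ₀) hD hexp
  have hmem (x : I × I) :
      segMap (Γ 1) x.2 * Complex.exp ((x.1 : ℝ) * D x.2) ∈ disc := by
    refine mem_ball_zero_iff.2 ?_
    rcases eq_or_ne x.2 0 with hx | hx
    · simp [hx, segMap_zero]
    · refine (norm_mul_exp_le_max _ _ _).trans_lt (max_lt ?_ ?_)
      · exact norm_segMap_lt_one (disc.norm_lt _) _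
      · exact hexp x.2 hx ▸ disc.norm_lt (Γ x.2)
  refine ⟨⟨⟨⟨fun x => ⟨_, hmem x⟩, hcont.subtype_mk hmem⟩, fun t => Subtype.ext ?_,
    fun t => Subtype.ext ?_⟩, fun s t ht => Subtype.ext ?_⟩, fun s t ht =>
    disc.coe_ne_zero_iff.1 (mul_ne_zero (hseg t ht) (Complex.exp_ne_zero _))⟩
  · simp [ray]
  · rcases eq_or_ne t 0 with rfl | ht
    · simp [segMap_zero, hΓ₀, disc.coe_zero]
    · simpa using (hexp t ht).symm
  · rcases ht with rfl | rfl
    · simp [ray, segMap_zero]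
    · simp [ray, hD₁]

theorem isCurve_inverseNomeDisc_comp {Γ : C(I, disc)} (hΓ₀ : Γ 0 = 0)
    (hΓ : (∀ t, Γ t = 0) ∨ ∀ t, t ≠ 0 → Γ t ≠ 0) :
    IsCurve ⟨fun t => inverseNomeDisc (Γ t), continuous_inverseNomeDisc.comp Γ.continuous⟩ := by
  refine ⟨inverseNomeDisc_eq_zero_iff.2 hΓ₀, hΓ.imp (fun h t => ?_) fun h t ht => ⟨?_, ?_⟩⟩
  · exact inverseNomeDisc_eq_zero_iff.2 (h t)
  · exact inverseNomeDisc_eq_zero_iff.not.2 (h t ht)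
  · exact inverseNome_ne_one (disc.norm_lt (Γ t))

/-- The image under the inverse nome of the segment from `0` to `z`; its class is the point of the
surface that corresponds to `z`. -/
def rayCurve (z : disc) : Curve :=
  ⟨_, isCurve_inverseNomeDisc_comp (ray_zero z) (ray_eq_zero_or_ne_zero z)⟩

/-- The inverse of the nome, as a map from the disc to the surface. -/
def toSurface (z : disc) : Surface := Surface.mk (rayCurve z)

theorem proj_toSurface (z : disc) : Surface.proj (toSurface z) = inverseNomeDisc z :=
  congrArg inverseNomeDisc (ray_one z)

theorem continuous_toSurface : Continuous toSurface := by
  refine Surface.continuous_mk.comp (Continuous.subtype_mk ?_ _)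
  refine ContinuousMap.continuous_of_continuous_uncurry _ (continuous_inverseNomeDisc.comp ?_)
  exact Continuous.subtype_mk (f := fun x : disc × I => ((x.2 : ℝ) : ℂ) * (x.1 : ℂ))
    (by fun_prop) _

theorem toSurface_lift {γ : Curve} {Γ : C(I, disc)} (hΓ₀ : Γ 0 = 0)
    (hΓ : ∀ t, inverseNomeDisc (Γ t) = γ.1 t) : toSurface (Γ 1) = Surface.mk γ := by
  rcases γ.2.2 with hγ | hγ
  · have hΓ_zero : ∀ t, Γ t = 0 := fun t =>
      inverseNomeDisc_eq_zero_iff.1 ((hΓ t).trans (hγ t))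
    refine congrArg Surface.mk (Subtype.ext (ContinuousMap.ext fun t => ?_))
    rw [hγ t, hΓ_zero 1]
    exact inverseNomeDisc_eq_zero_iff.2 (Subtype.ext (mul_zero _))
  · have hΓ_ne : ∀ t, t ≠ 0 → Γ t ≠ 0 := fun t ht => by
      rw [Ne, ← inverseNomeDisc_eq_zero_iff, hΓ]
      exact (hγ t ht).1
    obtain ⟨F, hF⟩ := exists_homotopyRel_ray hΓ₀ hΓ_ne
    have hF₀ : ∀ s, F (s, 0) = 0 := fun s => (F.eq_fst s (by simp)).trans (ray_zero _)
    refine Quotient.sound ⟨⟨⟨⟨fun x => inverseNomeDisc (F x),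
      continuous_inverseNomeDisc.comp F.continuous⟩, fun t => ?_, fun t => ?_⟩, fun s => ⟨?_, ?_⟩⟩⟩
    · exact congrArg inverseNomeDisc (F.apply_zero t)
    · exact (congrArg inverseNomeDisc (F.apply_one t)).trans (hΓ t)
    · exact isCurve_inverseNomeDisc_comp (Γ := F.toHomotopy.curry s) (hF₀ s) (Or.inr (hF s))
    · exact congrArg inverseNomeDisc (F.eq_fst s (by simp))

theorem bijective_toSurface : Function.Bijective toSurface := by
  constructor
  · intro z z' h
    have := lift_end_eq (Quotient.exact h) (ray_zero z) (ray_zero z') (fun _ => rfl) fun _ => rfl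
    rwa [ray_one, ray_one] at this
  · rintro ⟨γ⟩
    obtain ⟨Γ, hΓ₀, hΓ⟩ := exists_lift γ
    exact ⟨Γ 1, toSurface_lift hΓ₀ hΓ⟩

theorem isLocalHomeomorph_toSurface : IsLocalHomeomorph toSurface := by
  refine IsLocalHomeomorph.of_comp ?_ Surface.isLocalHomeomorph_proj continuous_toSurface
  rw [show Surface.proj ∘ toSurface = inverseNomeDisc from funext proj_toSurface]
  exact isLocalHomeomorph_inverseNomeDisc

end Uniformization

/-! ### The nome as a biholomorphic map -/

section Biholomorphism

/-- The nome, as a homeomorphism from the surface to the disc. -/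
def nomeHomeomorph : Surface ≃ₜ disc :=
  (isLocalHomeomorph_toSurface.toHomeomorphOfBijective bijective_toSurface).symm

theorem nomeHomeomorph_toSurface (z : disc) : nomeHomeomorph (toSurface z) = z :=
  nomeHomeomorph.apply_symm_apply z

theorem inverseNomeDisc_nomeHomeomorph (x : Surface) :
    inverseNomeDisc (nomeHomeomorph x) = Surface.proj x := by
  obtain ⟨z, rfl⟩ := bijective_toSurface.2 x
  rw [nomeHomeomorph_toSurface, proj_toSurface]

theorem coe_chartAt_surface (x : Surface) : (chartAt ℂ x : Surface → ℂ) = Surface.proj :=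
  (Surface.isLocalHomeomorph_proj x).choose_spec.2.symm

theorem contMDiff_toSurface : ContMDiff 𝓘(ℂ, ℂ) 𝓘(ℂ, ℂ) ω toSurface := fun z => by
  refine contMDiffAt_iff_target.2 ⟨continuous_toSurface.continuousAt, ?_⟩
  have hchart : extChartAt 𝓘(ℂ, ℂ) (toSurface z) ∘ toSurface = fun z : disc => inverseNome z := by
    ext u
    simp only [mfld_simps, coe_chartAt_surface, proj_toSurface]
    rfl
  rw [hchart]
  exact contMDiffAt_subtype_iff.2 (analyticOnNhd_inverseNome z z.2).contDiffAt.contMDiffAt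

theorem contMDiff_nomeHomeomorph : ContMDiff 𝓘(ℂ, ℂ) 𝓘(ℂ, ℂ) ω nomeHomeomorph := fun x => by
  refine contMDiffAt_iff_target.2 ⟨nomeHomeomorph.continuous.continuousAt, ?_⟩
  refine contMDiffAt_iff_source.2 (ContMDiffAt.contMDiffWithinAt (ContDiffAt.contMDiffAt ?_))
  have hsection : RightInvOn (fun v => (nomeHomeomorph ((chartAt ℂ x).symm v) : ℂ)) inverseNome
      (chartAt ℂ x).target := fun v hv => by
    refine (inverseNomeDisc_nomeHomeomorph _).trans ?_
    rw [← coe_chartAt_surface x]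
    exact (chartAt ℂ x).right_inv hv
  have hanalytic := analyticOnNhd_of_rightInvOn (chartAt ℂ x).open_target
    (continuous_subtype_val.comp_continuousOn
      (nomeHomeomorph.continuous.comp_continuousOn (chartAt ℂ x).continuousOn_symm))
    hsection fun _ _ => deriv_inverseNome_ne_zero (disc.norm_lt _)
  have := (hanalytic _ (mem_chart_target ℂ x)).contDiffAt (n := ω)
  simp only [mfld_simps] at this ⊢
  exact this

/-- The nome, as a biholomorphic map from the surface to the disc. -/
def nomeDiffeomorph : Surface ≃ₘ^ω⟮𝓘(ℂ, ℂ), 𝓘(ℂ, ℂ)⟯ disc :=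
  ⟨nomeHomeomorph.toEquiv, contMDiff_nomeHomeomorph, contMDiff_toSurface⟩

theorem nomeDiffeomorph_toSurface (z : disc) : nomeDiffeomorph (toSurface z) = z :=
  nomeHomeomorph_toSurface z

theorem nomeDiffeomorph_lift {γ : Curve} {Γ : C(unitInterval, disc)} (hΓ₀ : Γ 0 = 0)
    (hΓ : ∀ t, inverseNomeDisc (Γ t) = γ.1 t) : nomeDiffeomorph (Surface.mk γ) = Γ 1 := by
  rw [← toSurface_lift hΓ₀ hΓ, nomeDiffeomorph_toSurface]

theorem proj_nomeDiffeomorph_symm (z : disc) :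
    Surface.proj (nomeDiffeomorph.symm z) = inverseNome z :=
  proj_toSurface z

theorem nomeDiffeomorph_origin : nomeDiffeomorph Surface.origin = 0 :=
  nomeDiffeomorph_lift (Γ := .const _ 0) rfl fun _ => inverseNomeDisc_zero.trans (mul_zero _).symm

end Biholomorphism

/-! ### The nome formula on the first sheet -/

section FirstSheet

open scoped unitInterval

variable {w : ℂ}

theorem notMem_Ici_of_mem_doublySlitPlane (hw : w ∈ doublySlitPlane) :
    w ∉ Complex.ofReal '' Ici (1 : ℝ) :=
  one_sub_mem_slitPlane_iff.1 hw.2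

theorem continuous_seg :
    Continuous fun w : {w : ℂ // w ∉ Complex.ofReal '' Ici (1 : ℝ)} => Surface.seg w w.2 := by
  refine Surface.continuous_mk.comp (Continuous.subtype_mk ?_ _)
  refine ContinuousMap.continuous_of_continuous_uncurry _ ?_
  change Continuous fun x : {w : ℂ // w ∉ Complex.ofReal '' Ici (1 : ℝ)} × I =>
    ((x.2 : ℝ) : ℂ) * x.1
  fun_prop

/- On the ray through the nome of `i` the inverse nome takes the values `k ^ 2` with `k` real and
`|k| < 1`, so the image curve stays in the unit disc, where the homotopy class is determined by the
endpoint. -/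
theorem toSurface_nomeDisc_I : toSurface (nomeDisc UpperHalfPlane.I) =
    Surface.seg (1 / 2) (notMem_Ici_of_mem_doublySlitPlane half_mem_doublySlitPlane) := by
  refine (Quotient.sound (homotopic_of_norm_lt ?_ (fun t => ?_) ?_)).symm
  · exact norm_segMap_lt_one (by norm_num)
  · have hexp : Real.exp (-Real.pi) < 1 := Real.exp_lt_one_iff.2 (neg_lt_zero.2 Real.pi_pos)
    have hray_nonneg : 0 ≤ (t : ℝ) * Real.exp (-Real.pi) := mul_nonneg t.2.1 (Real.exp_nonneg _)
    have hray_lt_one : (t : ℝ) * Real.exp (-Real.pi) < 1 :=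
      (mul_le_of_le_one_left (Real.exp_nonneg _) t.2.2).trans_lt hexp
    have hray : (ray (nomeDisc UpperHalfPlane.I) t : ℂ) =
        (Real.sqrt (t * Real.exp (-Real.pi)) : ℂ) ^ 2 := by
      rw [← Complex.ofReal_pow, Real.sq_sqrt hray_nonneg, Complex.ofReal_mul, ← nome_I]
      rfl
    change ‖inverseNome (ray (nomeDisc UpperHalfPlane.I) t)‖ < 1
    rw [hray]
    refine norm_inverseNome_sq_ofReal_lt_one ?_
    rwa [abs_of_nonneg (Real.sqrt_nonneg _), Real.sqrt_lt' one_pos, one_pow]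
  · refine (congrArg inverseNomeDisc (ray_one _)).trans ?_
    rw [inverseNomeDisc_nomeDisc, modularLambda_I]
    exact (segMap_one _).symm

theorem nomeDiffeomorph_seg (hw : w ∈ doublySlitPlane) :
    nomeDiffeomorph (Surface.seg w (notMem_Ici_of_mem_doublySlitPlane hw)) =
      nomeDisc (slitSection w) := by
  have : PreconnectedSpace doublySlitPlane :=
    Subtype.preconnectedSpace isPreconnected_doublySlitPlane
  refine eqOn_of_inverseNomeDisc_eq (A := doublySlitPlane) (s := univ)
    (f := fun w => nomeDiffeomorph (Surface.seg w (notMem_Ici_of_mem_doublySlitPlane w.2)))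
    (g := fun w => nomeDisc (slitSection w)) isPreconnected_univ
    (nomeHomeomorph.continuous.comp (continuous_seg.comp (continuous_subtype_val.subtype_mk
      fun w : doublySlitPlane => notMem_Ici_of_mem_doublySlitPlane w.2))).continuousOn
    (continuous_nomeDisc.comp continuousOn_slitSection.domRestrict).continuousOn
    (fun w _ => ?_) (a := ⟨1 / 2, half_mem_doublySlitPlane⟩) (mem_univ _) ?_ (mem_univ ⟨w, hw⟩)
  · rw [inverseNomeDisc_nomeDisc, modularLambda_slitSection w.2]
    exact (inverseNomeDisc_nomeHomeomorph _).trans (segMap_one _)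
  · rw [slitSection_half, ← toSurface_nomeDisc_I, nomeDiffeomorph_toSurface]

theorem nomeDiffeomorph_seg_eq_exp (hw : w ∈ doublySlitPlane) : ellipticK w ≠ 0 ∧
    (nomeDiffeomorph (Surface.seg w (notMem_Ici_of_mem_doublySlitPlane hw)) : ℂ) =
      Complex.exp (-(Real.pi : ℂ) * (ellipticK (1 - w) / ellipticK w)) := by
  rw [nomeDiffeomorph_seg hw, ellipticK_eq_thetaThree hw, ellipticK_one_sub_eq_thetaThree hw,
    exp_neg_pi_mul_div_eq_nome]
  refine ⟨mul_ne_zero (by simp) (pow_ne_zero 2 (thetaThree_ne_zero ?_)), rfl⟩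
  exact norm_nome_lt_one (slitSection w).2

end FirstSheet

/-! ### Analytic continuation along admissible curves -/

section Continuation

open scoped UpperHalfPlane unitInterval

theorem isLocalHomeomorph_coe_modularLambda :
    IsLocalHomeomorph fun τ : ℍ => (modularLambda τ : ℂ) :=
  TwicePuncturedPlane.isOpen.isOpenEmbedding_subtypeVal.isLocalHomeomorph.comp
    isLocalHomeomorph_modularLambda

/-- A chosen restriction of the modular function to a neighbourhood of `τ` on which it is
invertible. -/
def lambdaChart (τ : ℍ) : OpenPartialHomeomorph ℍ ℂ :=
  (isLocalHomeomorph_coe_modularLambda τ).choose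

theorem mem_lambdaChart_source (τ : ℍ) : τ ∈ (lambdaChart τ).source :=
  (isLocalHomeomorph_coe_modularLambda τ).choose_spec.1

theorem lambdaChart_apply (τ ρ : ℍ) : lambdaChart τ ρ = modularLambda ρ :=
  (congrFun (isLocalHomeomorph_coe_modularLambda τ).choose_spec.2 ρ).symm

theorem lambdaChart_symm_modularLambda (τ : ℍ) : (lambdaChart τ).symm (modularLambda τ) = τ := by
  rw [← lambdaChart_apply τ, (lambdaChart τ).left_inv (mem_lambdaChart_source τ)]

theorem modularLambda_mem_lambdaChart_target (τ : ℍ) :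
    (modularLambda τ : ℂ) ∈ (lambdaChart τ).target := by
  rw [← lambdaChart_apply τ]
  exact (lambdaChart τ).map_source (mem_lambdaChart_source τ)

theorem modularLambda_lambdaChart_symm {τ : ℍ} {v : ℂ} (hv : v ∈ (lambdaChart τ).target) :
    modularLambda ((lambdaChart τ).symm v) = v := by
  rw [← lambdaChart_apply τ, (lambdaChart τ).right_inv hv]

theorem analyticOnNhd_lambdaChart_symm (τ : ℍ) :
    AnalyticOnNhd ℂ (fun v => ((lambdaChart τ).symm v : ℂ)) (lambdaChart τ).target :=
  analyticOnNhd_of_rightInvOn (f := inverseNome ∘ nome) (lambdaChart τ).open_target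
    (UpperHalfPlane.continuous_coe.comp_continuousOn (lambdaChart τ).continuousOn_symm)
    (fun _ hv => modularLambda_lambdaChart_symm hv)
    fun _ _ => deriv_inverseNome_nome_ne_zero (UpperHalfPlane.im_pos _)

theorem lambdaChart_symm_eventuallyEq {τ : ℍ} {ρ : ℂ → ℍ} {v : ℂ} (hρ : ContinuousAt ρ v)
    (hinv : ∀ᶠ u in 𝓝 v, modularLambda (ρ u) = u) (hmem : ρ v ∈ (lambdaChart τ).source) :
    (lambdaChart τ).symm =ᶠ[𝓝 v] ρ := by
  filter_upwards [hinv, hρ.eventually ((lambdaChart τ).open_source.mem_nhds hmem)] with u hu hsource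
  conv_lhs => rw [← hu, ← lambdaChart_apply τ, (lambdaChart τ).left_inv hsource]

theorem isContinuation_comp_lambdaChart_symm {γ : C(I, ℂ)} {T : C(I, ℍ)} {t₀ : I}
    (hT : ∀ t, t₀ ≤ t → modularLambda (T t) = γ t) {f g : ℂ → ℂ}
    (hg : ∀ τ : ℍ, AnalyticAt ℂ g τ)
    (hf : (fun w => g ((lambdaChart (T t₀)).symm w)) =ᶠ[𝓝 (γ t₀)] f) :
    IsContinuation γ t₀ f fun t w => g ((lambdaChart (T t)).symm w) := by
  have hmem : ∀ t, t₀ ≤ t → γ t ∈ (lambdaChart (T t)).target := fun t ht =>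
    hT t ht ▸ modularLambda_mem_lambdaChart_target (T t)
  refine ⟨hf, fun t ht => AnalyticAt.fun_comp (hg _)
    (analyticOnNhd_lambdaChart_symm (T t) _ (hmem t ht)), fun t _ => ?_⟩
  have hsource : ∀ᶠ s in 𝓝 t, T s ∈ (lambdaChart (T t)).source :=
    T.continuous.continuousAt.eventually
      ((lambdaChart (T t)).open_source.mem_nhds (mem_lambdaChart_source (T t)))
  filter_upwards [self_mem_nhdsWithin, mem_nhdsWithin_of_mem_nhds hsource] with s hs hTs
  have hsections : (lambdaChart (T t)).symm =ᶠ[𝓝 (γ s)] (lambdaChart (T s)).symm := by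
    refine lambdaChart_symm_eventuallyEq ((lambdaChart (T s)).continuousAt_symm (hmem s hs)) ?_ ?_
    · filter_upwards [(lambdaChart (T s)).open_target.mem_nhds (hmem s hs)] with u hu
      exact modularLambda_lambdaChart_symm hu
    · rwa [← hT s hs, lambdaChart_symm_modularLambda]
  exact hsections.symm.fun_comp fun τ : ℍ => g τ

theorem isContinuation_of_eq_comp_slitSection {γ : C(I, ℂ)} {T : C(I, ℍ)} {t₀ : I}
    (hT : ∀ t, t₀ ≤ t → modularLambda (T t) = γ t) (hγ : γ t₀ ∈ doublySlitPlane)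
    (hT₀ : T t₀ = slitSection (γ t₀)) {f g : ℂ → ℂ} (hg : ∀ τ : ℍ, AnalyticAt ℂ g τ)
    (hf : ∀ w ∈ doublySlitPlane, f w = g (slitSection w)) :
    IsContinuation γ t₀ f fun t w => g ((lambdaChart (T t)).symm w) := by
  have hslit : doublySlitPlane ∈ 𝓝 (γ t₀) := isOpen_doublySlitPlane.mem_nhds hγ
  refine isContinuation_comp_lambdaChart_symm hT hg ?_
  have hsections := lambdaChart_symm_eventuallyEq (τ := T t₀)
    (continuousOn_slitSection.continuousAt hslit)
    (by filter_upwards [hslit] with u hu using modularLambda_slitSection hu)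
    (hT₀ ▸ mem_lambdaChart_source (T t₀))
  filter_upwards [hsections, hslit] with u hu hu_slit
  rw [hu, hf u hu_slit]

theorem isCurve_restrict {γ : Curve} {t₀ : I} (h : γ.1 t₀ ≠ 0) :
    IsCurve (γ.1.comp ⟨fun t => t * t₀, by fun_prop⟩) := by
  have ht₀ : t₀ ≠ 0 := fun h₀ => h (h₀ ▸ γ.2.1)
  refine ⟨by simp [γ.2.1], Or.inr fun t ht => ?_⟩
  exact γ.2.2.resolve_left (fun hconst => h (hconst t₀)) _ (mul_ne_zero ht ht₀)

theorem lift_eq_nomeDisc {γ : Curve} {Γ : C(I, disc)} (hΓ₀ : Γ 0 = 0)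
    (hΓ : ∀ t, inverseNomeDisc (Γ t) = γ.1 t) {t₀ : I} (ht₀ : ∀ t, t ≤ t₀ → ‖γ.1 t‖ < 1)
    (hγ : γ.1 t₀ ∈ doublySlitPlane) : Γ t₀ = nomeDisc (slitSection (γ.1 t₀)) := by
  have hcurve := isCurve_restrict (ne_of_mem_doublySlitPlane hγ).1
  have hlift := nomeDiffeomorph_lift (γ := ⟨_, hcurve⟩)
    (Γ := Γ.comp ⟨fun t => t * t₀, by fun_prop⟩) (by simp [hΓ₀]) fun t => hΓ _
  have hseg : Surface.mk ⟨_, hcurve⟩ =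
      Surface.seg (γ.1 t₀) (notMem_Ici_of_mem_doublySlitPlane hγ) := by
    refine Quotient.sound (homotopic_of_norm_lt (fun t => ht₀ _ ?_) ?_ ?_)
    · exact mul_le_of_le_one_left t₀.2.1 t.2.2
    · exact norm_segMap_lt_one (ht₀ t₀ le_rfl)
    · simp [segMap]
  rw [hseg, nomeDiffeomorph_seg hγ] at hlift
  simpa using hlift.symm

theorem exists_upperHalfPlane_lift {γ : Curve} {t₀ : I} (ht₀ : ∀ t, t ≤ t₀ → ‖γ.1 t‖ < 1)
    (hγ : γ.1 t₀ ∈ doublySlitPlane) : ∃ T : C(I, ℍ), T t₀ = slitSection (γ.1 t₀) ∧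
      (∀ t, t₀ ≤ t → modularLambda (T t) = γ.1 t) ∧
      nomeDiffeomorph (Surface.mk γ) = nomeDisc (T 1) := by
  have hγ₀ := (ne_of_mem_doublySlitPlane hγ).1
  have ht₀_pos : 0 < t₀ := unitInterval.pos_iff_ne_zero.2 fun h => hγ₀ (h ▸ γ.2.1)
  have hne := γ.2.2.resolve_left fun hconst => hγ₀ (hconst t₀)
  obtain ⟨T, hT₀, hT⟩ := exists_lift_modularLambda (f := γ.1) (t₁ := t₀)
    (fun t ht => hne t (ht₀_pos.trans_le ht).ne') (modularLambda_slitSection hγ)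
  obtain ⟨Γ, hΓ₀, hΓ⟩ := exists_lift γ
  have hΓT : EqOn Γ (fun t => nomeDisc (T t)) (Ici t₀) :=
    eqOn_of_inverseNomeDisc_eq isPreconnected_Ici Γ.continuous.continuousOn
      (continuous_nomeDisc.comp T.continuous).continuousOn
      (fun t ht => by rw [hΓ, inverseNomeDisc_nomeDisc, hT t ht]) self_mem_Ici
      (by rw [lift_eq_nomeDisc hΓ₀ hΓ ht₀ hγ, hT₀])
  exact ⟨T, hT₀, hT, (nomeDiffeomorph_lift hΓ₀ hΓ).trans (hΓT (mem_Ici.2 unitInterval.le_one'))⟩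

theorem exists_continuation {γ : Curve} {t₀ : I} (ht₀ : ∀ t, t ≤ t₀ → ‖γ.1 t‖ < 1)
    (hγ₀ : γ.1 t₀ ∉ Complex.ofReal '' Iic (0 : ℝ)) :
    ∃ F G : I → ℂ → ℂ, IsContinuation γ.1 t₀ ellipticK F ∧
      IsContinuation γ.1 t₀ (fun w => ellipticK (1 - w)) G ∧ F 1 (γ.1 1) ≠ 0 ∧
      (nomeDiffeomorph (Surface.mk γ) : ℂ) =
        Complex.exp (-(Real.pi : ℂ) * (G 1 (γ.1 1) / F 1 (γ.1 1))) := by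
  have hγ := mem_doublySlitPlane hγ₀ (notMem_of_norm_lt (ht₀ t₀ le_rfl))
  obtain ⟨T, hT₀, hT, hnome⟩ := exists_upperHalfPlane_lift ht₀ hγ
  have hK_analytic (τ : ℍ) : AnalyticAt ℂ (fun τ => Real.pi / 2 * thetaThree (nome τ) ^ 2) τ :=
    analyticAt_const.mul ((analyticAt_thetaThree_nome τ.2).pow 2)
  have hK'_analytic (τ : ℍ) : AnalyticAt ℂ
      (fun τ => Real.pi / 2 * (-Complex.I * τ * thetaThree (nome τ) ^ 2)) τ :=
    analyticAt_const.mul ((analyticAt_const.mul analyticAt_id).mul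
      ((analyticAt_thetaThree_nome τ.2).pow 2))
  have hend : (lambdaChart (T 1)).symm (γ.1 1) = T 1 := by
    rw [← hT 1 unitInterval.le_one', lambdaChart_symm_modularLambda]
  refine ⟨_, _, isContinuation_of_eq_comp_slitSection hT hγ hT₀ hK_analytic fun w hw =>
    ellipticK_eq_thetaThree hw, isContinuation_of_eq_comp_slitSection hT hγ hT₀ hK'_analytic
    fun w hw => ellipticK_one_sub_eq_thetaThree hw, ?_, ?_⟩
  · exact mul_ne_zero (by simp) (pow_ne_zero 2 (thetaThree_ne_zero
      (norm_nome_lt_one (UpperHalfPlane.im_pos _))))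
  · simp only [hend]
    rw [exp_neg_pi_mul_div_eq_nome, hnome]
    rfl

end Continuation

/-! ### The Maclaurin series of the inverse nome -/

section MaclaurinSeries

open Asymptotics

theorem isBigO_lacunarySeries_sub {e : ℤ → ℕ} (he : ∀ n, n.natAbs ≤ e n + 1) (s : Finset ℤ) {k : ℕ}
    (hk : ∀ n, n ∉ s → k ≤ e n) :
    (fun z => lacunarySeries e z - ∑ n ∈ s, z ^ e n) =O[𝓝 0] fun z => z ^ k := by
  have hsum : Summable fun n : ℤ => (1 / 2 : ℝ) ^ e n :=
    summable_pow_of_natAbs_le he (by norm_num) (by norm_num)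
  refine IsBigO.of_bound (∑' n : ↥((s : Set ℤ)ᶜ), 2 ^ k * (1 / 2 : ℝ) ^ e n) ?_
  filter_upwards [Metric.ball_mem_nhds (0 : ℂ) one_half_pos] with z hz
  have hz_half : ‖z‖ < 1 / 2 := mem_ball_zero_iff.1 hz
  have hsplit := (summable_norm_pow_of_natAbs_le he
    (hz_half.trans one_half_lt_one)).of_norm.sum_add_tsum_compl (s := s)
  rw [lacunarySeries, ← hsplit, add_sub_cancel_left, ← tsum_mul_right]
  refine tsum_of_norm_bounded (((hsum.mul_left (2 ^ k)).subtype _).mul_right _).hasSum fun n => ?_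
  obtain ⟨m, hm⟩ := Nat.exists_eq_add_of_le (hk n n.2)
  have hcancel : (2 : ℝ) ^ k * (1 / 2) ^ k = 1 := by rw [← mul_pow]; norm_num
  simp only [Function.comp_apply, norm_mul, norm_pow, hm, pow_add]
  calc ‖z‖ ^ k * ‖z‖ ^ m ≤ ‖z‖ ^ k * (1 / 2) ^ m := by gcongr
    _ = 2 ^ k * ((1 / 2) ^ k * (1 / 2) ^ m) * ‖z‖ ^ k := by
      linear_combination -(‖z‖ ^ k * (1 / 2) ^ m) * hcancel

theorem isBigO_thetaThree_sub : (fun z => thetaThree z - (1 + 2 * z)) =O[𝓝 0] fun z => z ^ 3 := by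
  have h := isBigO_lacunarySeries_sub natAbs_le_squareExp {-1, 0, 1} (k := 3) fun n hn => by
    simp only [Finset.mem_insert, Finset.mem_singleton, not_or] at hn
    zify
    rw [cast_squareExp]
    rcases le_or_gt n 0 with hneg | hpos
    · nlinarith [show n ≤ -2 by omega]
    · nlinarith [show 2 ≤ n by omega]
  have hsum (z : ℂ) : ∑ n ∈ {-1, 0, 1}, z ^ squareExp n = 1 + 2 * z := by
    rw [Finset.sum_insert (by decide), Finset.sum_pair (by decide)]
    change z ^ 1 + (z ^ 0 + z ^ 1) = _
    ring
  exact h.congr_left fun z => by rw [hsum, thetaThree]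

theorem isBigO_thetaTwo_sub :
    (fun z => thetaTwo z - (2 + 2 * z ^ 2)) =O[𝓝 0] fun z => z ^ 3 := by
  have h := isBigO_lacunarySeries_sub natAbs_le_pronicExp {-2, -1, 0, 1} (k := 3) fun n hn => by
    simp only [Finset.mem_insert, Finset.mem_singleton, not_or] at hn
    zify
    rw [cast_pronicExp]
    rcases le_or_gt n 0 with hneg | hpos
    · nlinarith [show n ≤ -3 by omega]
    · nlinarith [show 2 ≤ n by omega]
  have hsum (z : ℂ) : ∑ n ∈ {-2, -1, 0, 1}, z ^ pronicExp n = 2 + 2 * z ^ 2 := by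
    rw [Finset.sum_insert (by decide), Finset.sum_insert (by decide), Finset.sum_pair (by decide)]
    change z ^ 2 + (z ^ 0 + (z ^ 0 + z ^ 2)) = _
    ring
  exact h.congr_left fun z => by rw [hsum, thetaTwo]

theorem isBigO_mul_of_continuousAt {α 𝕜 : Type*} [TopologicalSpace α] [NormedField 𝕜]
    {f g h : α → 𝕜} {a : α} (hf : f =O[𝓝 a] h) (hg : ContinuousAt g a) :
    (fun x => f x * g x) =O[𝓝 a] h := by
  simpa only [mul_one] using hf.mul (hg.isBigO_one 𝕜)

theorem isBigO_pow_four_sub {α 𝕜 : Type*} [TopologicalSpace α] [NormedField 𝕜]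
    {f g h : α → 𝕜} {a : α} (hf : ContinuousAt f a) (hg : ContinuousAt g a)
    (hfg : (fun x => f x - g x) =O[𝓝 a] h) : (fun x => f x ^ 4 - g x ^ 4) =O[𝓝 a] h := by
  have hcofactor :
      ContinuousAt (fun x => f x ^ 3 + f x ^ 2 * g x + f x * g x ^ 2 + g x ^ 3) a := by
    fun_prop
  exact (isBigO_mul_of_continuousAt hfg hcofactor).congr_left fun x => by ring

/- After multiplication by `θ₃ ^ 4` and replacement of both theta constants by their Taylor
polynomials, the difference is `z ^ 4` times a polynomial. -/
theorem isBigO_inverseNome_sub :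
    (fun z => inverseNome z - (16 * z - 128 * z ^ 2 + 704 * z ^ 3)) =O[𝓝 0] fun z => z ^ 4 := by
  have hthree_cont := (differentiableAt_thetaThree (z := 0) (by simp)).continuousAt
  have htwo := isBigO_pow_four_sub (differentiableAt_thetaTwo (by simp)).continuousAt
    (by fun_prop) isBigO_thetaTwo_sub
  have hthree := isBigO_pow_four_sub hthree_cont (by fun_prop) isBigO_thetaThree_sub
  have hid := isBigO_refl (fun z : ℂ => z) (𝓝 0)
  have htwo_term := (hid.mul htwo).congr_right fun z => (pow_succ' z 3).symm
  have hthree_term := ((isBigO_mul_of_continuousAt hid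
    (g := fun z => 16 - 128 * z + 704 * z ^ 2) (by fun_prop)).mul hthree).congr_right
    fun z => (pow_succ' z 3).symm
  have hpolynomials := isBigO_mul_of_continuousAt (isBigO_refl (fun z : ℂ => z ^ 4) (𝓝 0))
    (g := fun z => -3072 - 12960 * z - 20480 * z ^ 2 - 11200 * z ^ 3 + 16 * z ^ 5) (by fun_prop)
  refine (isBigO_mul_of_continuousAt ((htwo_term.add hpolynomials).sub hthree_term)
    ((hthree_cont.pow 4).inv₀ (pow_ne_zero 4 (thetaThree_ne_zero (by simp))))).congr' ?_ .rfl
  filter_upwards [Metric.ball_mem_nhds (0 : ℂ) one_pos] with z hz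
  have := thetaThree_ne_zero (mem_ball_zero_iff.1 hz)
  rw [inverseNome, Pi.inv_apply, Pi.pow_apply]
  field_simp
  ring

section Coefficients

variable {𝕜 : Type*} [NontriviallyNormedField 𝕜]

theorem isBigO_pow_of_add_mul {c : 𝕜} {g : 𝕜 → 𝕜} (hg : ContinuousAt g 0) {n : ℕ}
    (h : (fun z => c + z * g z) =O[𝓝[≠] 0] fun z => z ^ (n + 1)) :
    c = 0 ∧ g =O[𝓝[≠] 0] fun z => z ^ n := by
  have hlim : Tendsto (fun z => c + z * g z) (𝓝[≠] 0) (𝓝 c) := by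
    have : ContinuousAt (fun z => c + z * g z) 0 := by fun_prop
    simpa using this.tendsto.mono_left nhdsWithin_le_nhds
  have hpow : Tendsto (fun z : 𝕜 => z ^ (n + 1)) (𝓝[≠] 0) (𝓝 0) := by
    simpa using ((continuous_pow (n + 1)).tendsto (0 : 𝕜)).mono_left nhdsWithin_le_nhds
  obtain rfl : c = 0 := tendsto_nhds_unique hlim (h.trans_tendsto hpow)
  refine ⟨rfl, (h.mul (isBigO_refl (fun z : 𝕜 => z⁻¹) (𝓝[≠] 0))).congr' ?_ ?_⟩
  · filter_upwards [self_mem_nhdsWithin] with z hz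
    rw [zero_add, mul_comm z, mul_inv_cancel_right₀ hz]
  · filter_upwards [self_mem_nhdsWithin] with z hz
    rw [pow_succ, mul_inv_cancel_right₀ hz]

theorem eq_zero_of_isBigO_sum_pow {n : ℕ} {a : ℕ → 𝕜}
    (h : (fun z => ∑ k ∈ Finset.range n, a k * z ^ k) =O[𝓝[≠] 0] fun z => z ^ n) :
    ∀ k < n, a k = 0 := by
  induction n generalizing a with
  | zero => simp
  | succ n ih =>
    obtain ⟨hzero, hsucc⟩ := isBigO_pow_of_add_mul (c := a 0)
      (g := fun z => ∑ k ∈ Finset.range n, a (k + 1) * z ^ k) (by fun_prop)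
      (h.congr_left fun z => by
        simp only [Finset.sum_range_succ', Finset.mul_sum, pow_zero, mul_one, pow_succ']
        rw [add_comm]
        exact congrArg _ (Finset.sum_congr rfl fun k _ => by ring))
    rintro (_ | k) hk
    exacts [hzero, ih hsucc k (by omega)]

theorem iteratedDeriv_div_factorial_eq_of_isBigO [CompleteSpace 𝕜] [CharZero 𝕜] {f : 𝕜 → 𝕜}
    (hf : AnalyticAt 𝕜 f 0) {n : ℕ} {a : ℕ → 𝕜}
    (h : (fun z => f z - ∑ k ∈ Finset.range n, a k * z ^ k) =O[𝓝 0] fun z => z ^ n) :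
    ∀ k < n, iteratedDeriv k f 0 / k.factorial = a k := by
  have htaylor : (fun z => f z - ∑ k ∈ Finset.range n, iteratedDeriv k f 0 / k.factorial * z ^ k)
      =O[𝓝 0] fun z => z ^ n := by
    refine ((hf.hasFPowerSeriesAt.isBigO_sub_partialSum_pow n).congr_left fun z => ?_).trans
      (IsBigO.of_norm_right ?_)
    · simp [FormalMultilinearSeries.partialSum, mul_comm]
    · simpa only [norm_pow] using isBigO_refl _ _
  have hdiff := ((h.sub htaylor).mono (nhdsWithin_le_nhds (s := {0}ᶜ))).congr_left fun z =>
    show _ = ∑ k ∈ Finset.range n, (iteratedDeriv k f 0 / k.factorial - a k) * z ^ k by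
      simp only [sub_sub_sub_cancel_left, sub_mul, Finset.sum_sub_distrib]
  exact fun k hk => sub_eq_zero.1 (eq_zero_of_isBigO_sum_pow hdiff k hk)

end Coefficients

/-- The Maclaurin coefficients of the inverse nome. -/
def inverseNomeCoeff (n : ℕ) : ℂ := iteratedDeriv n inverseNome 0 / n.factorial

theorem hasSum_inverseNomeCoeff {z : ℂ} (hz : ‖z‖ < 1) :
    HasSum (fun n => inverseNomeCoeff n * z ^ n) (inverseNome z) := by
  refine (Complex.hasSum_taylorSeries_on_ball analyticOnNhd_inverseNome.differentiableOn
    (mem_ball_zero_iff.2 hz)).congr_fun fun n => ?_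
  simp only [inverseNomeCoeff, sub_zero, smul_eq_mul]
  ring

theorem inverseNomeCoeff_eq : inverseNomeCoeff 0 = 0 ∧ inverseNomeCoeff 1 = 16 ∧
    inverseNomeCoeff 2 = -128 ∧ inverseNomeCoeff 3 = 704 := by
  have hcoeff := iteratedDeriv_div_factorial_eq_of_isBigO (analyticOnNhd_inverseNome 0 (by simp))
    (n := 4) (a := fun n => ([0, 16, -128, 704] : List ℂ).getD n 0)
    (isBigO_inverseNome_sub.congr_left fun z => by
      rw [Finset.sum_range_succ, Finset.sum_range_succ, Finset.sum_range_succ, Finset.sum_range_one]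
      change _ = _ - (0 * z ^ 0 + 16 * z ^ 1 + -128 * z ^ 2 + 704 * z ^ 3)
      ring)
  exact ⟨hcoeff 0 (by norm_num), hcoeff 1 (by norm_num), hcoeff 2 (by norm_num),
    hcoeff 3 (by norm_num)⟩

end MaclaurinSeries

end NomeSurface

end

theorem mainTheorem2 :
    ∃ ψ : Surface ≃ₘ^ω⟮𝓘(ℂ, ℂ), 𝓘(ℂ, ℂ)⟯ disc,
      -- normalization at the origin
      (ψ Surface.origin : ℂ) = 0 ∧
      -- the nome formula with principal branches on the doubly slit first sheet
      (∀ (w : ℂ) (_ : w ∉ Complex.ofReal '' Set.Iic (0 : ℝ))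
        (h₁ : w ∉ Complex.ofReal '' Set.Ici (1 : ℝ)),
        ellipticK w ≠ 0 ∧
        (ψ (Surface.seg w h₁) : ℂ) =
          Complex.exp (-(Real.pi : ℂ) * (ellipticK (1 - w) / ellipticK w))) ∧
      -- the nome formula on all sheets, by analytic continuation along curves
      (∀ (γ : Curve) (t₀ : unitInterval), (∀ t, t ≤ t₀ → ‖γ.1 t‖ < 1) →
        γ.1 t₀ ∉ Complex.ofReal '' Set.Iic (0 : ℝ) →
        ∃ F G : unitInterval → ℂ → ℂ,
          IsContinuation γ.1 t₀ ellipticK F ∧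
          IsContinuation γ.1 t₀ (fun w => ellipticK (1 - w)) G ∧
          F 1 (γ.1 1) ≠ 0 ∧
          (ψ (Surface.mk γ) : ℂ) =
            Complex.exp (-(Real.pi : ℂ) * (G 1 (γ.1 1) / F 1 (γ.1 1)))) ∧
      -- the Maclaurin series of the inverse, convergent in the whole disc
      (∃ a : ℕ → ℂ, a 0 = 0 ∧ a 1 = 16 ∧ a 2 = -128 ∧ a 3 = 704 ∧
        ∀ z : disc, HasSum (fun n : ℕ => a n * (z : ℂ) ^ n) (Surface.proj (ψ.symm z))) := by
  refine ⟨nomeDiffeomorph, congrArg Subtype.val nomeDiffeomorph_origin,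
    fun _ h₀ h₁ => nomeDiffeomorph_seg_eq_exp (mem_doublySlitPlane h₀ h₁),
    fun _ _ ht₀ hγ₀ => exists_continuation ht₀ hγ₀, inverseNomeCoeff, inverseNomeCoeff_eq.1,
    inverseNomeCoeff_eq.2.1, inverseNomeCoeff_eq.2.2.1, inverseNomeCoeff_eq.2.2.2, fun z => ?_⟩
  rw [proj_nomeDiffeomorph_symm]
  exact hasSum_inverseNomeCoeff (disc.norm_lt z)
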